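/- Let $n\ge 1$, $p>1$ and $1\le q<\infty$ with $q>\frac{n(p-1)}{2}$. Then there is a positive function $C=C_{n,p,q}(r,T)$ of $r\geq 0$, $T>0$ such that the following holds. Let $f\in C^1(\mathbb{R})$ satisfy $f(0)=0$ and, for some constant $K>0$, $$|f(a)-f(b)|\le K\big(|a|^{p-1}+|b|^{p-1}\big)|a-b|\qquad\text{for all } a,b\in\mathbb{R},$$ and let $y_0\in L^q(\mathbb{R}^n)$. Then there is a $T^*>0$ such that the semilinear heat equation $$\partial_t y-\Delta y+f(y)=0\ \text{ in }\mathbb{R}^n\times(0,T^*),\qquad y(\cdot,0)=y_0,$$ has one and only one solution $y\in C([0,T^*];L^q(\mathbb{R}^n))\cap L^\infty_{loc}((0,T^*);L^\infty(\mathbb{R}^n))$, and this solution satisfies $$\|y(t)\|_{q}+t^{\frac{n}{2q}}\|y(t)\|_{\infty}\le C(\|y_0\|_q,T^*)\,\|y_0\|_{q}\qquad\text{for } 0<t\le T^*.$$ Here a solution is understood in the mild sense: $y(0)=y_0$ and, for all $0<\tau<t<T^*$, $$y(t)=e^{(t-\tau)\Delta}y(\tau)-\int_\tau^t e^{(t-s)\Delta}f(y(s))\,ds\quad\text{a.e.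 on }\mathbb{R}^n,$$ where $e^{t\Delta}\varphi(x)=(4\pi t)^{-n/2}\int_{\mathbb{R}^n}e^{-|x-z|^2/(4t)}\varphi(z)\,dz$. The solution found moreover satisfies this formula with $\tau=0$ and every $0<t\le T^*$, the time integral being absolutely convergent for almost every $x$. -/

import Mathlib

open MeasureTheory
open scoped ENNReal

noncomputable section

namespace SemilinearHeat

/-- The heat kernel `(4πt)^{-n/2} exp(-|x|²/(4t))` on `ℝⁿ`, used for `t > 0` only. -/
def heatKernel (n : ℕ) (t : ℝ) (x : EuclideanSpace ℝ (Fin n)) : ℝ :=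
  (4 * Real.pi * t) ^ (-((n : ℝ) / 2)) * Real.exp (-(‖x‖ ^ 2) / (4 * t))

/-- `(e^{tΔ} φ)(x) = ∫ K_t(x - z) φ(z) dz`, used for `t > 0` only. For `φ ∈ L^q` the integral
converges at every `x` and depends only on the almost-everywhere class of `φ`. -/
def heatSemigroup {n : ℕ} (t : ℝ) (φ : EuclideanSpace ℝ (Fin n) → ℝ)
    (x : EuclideanSpace ℝ (Fin n)) : ℝ :=
  ∫ z, heatKernel n t (x - z) * φ z

/-- The hypothesis on the nonlinearity: `f` is `C¹`, `f 0 = 0`, and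
`|f a - f b| ≤ K (|a|^{p-1} + |b|^{p-1}) |a - b|` for some `K > 0`. -/
structure PowerNonlinearity (p : ℝ) (f : ℝ → ℝ) : Prop where
  contDiff : ContDiff ℝ 1 f
  map_zero : f 0 = 0
  growth : ∃ K : ℝ, 0 < K ∧ ∀ a b : ℝ,
    |f a - f b| ≤ K * (|a| ^ (p - 1) + |b| ^ (p - 1)) * |a - b|

/-- Duhamel's formula for `∂_t y - Δy + f(y) = 0` between the times `τ < t`:
`y(t) = e^{(t-τ)Δ} y(τ) - ∫_τ^t e^{(t-s)Δ} f(y(s)) ds` almost everywhere on `ℝⁿ`,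
the time integral being absolutely convergent. -/
def Duhamel {n : ℕ} {q : ℝ≥0∞} (f : ℝ → ℝ)
    (y : ℝ → Lp ℝ q (volume : Measure (EuclideanSpace ℝ (Fin n)))) (τ t : ℝ) : Prop :=
  ∀ᵐ x : EuclideanSpace ℝ (Fin n),
    IntervalIntegrable (fun s => heatSemigroup (t - s) (fun z => f (y s z)) x) volume τ t ∧
    y t x = heatSemigroup (t - τ) (y τ) x
      - ∫ s in τ..t, heatSemigroup (t - s) (fun z => f (y s z)) x

/-- `y ∈ L^∞_loc((0,T); L^∞(ℝⁿ))`: essentially bounded on each compact `[a,b] ⊂ (0,T)`. -/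
def LocallyBounded {n : ℕ} {q : ℝ≥0∞}
    (y : ℝ → Lp ℝ q (volume : Measure (EuclideanSpace ℝ (Fin n)))) (T : ℝ) : Prop :=
  ∀ a b : ℝ, 0 < a → a ≤ b → b < T → ∃ M : NNReal,
    ∀ᵐ s ∂((volume : Measure ℝ).restrict (Set.Icc a b)), eLpNorm (y s) ∞ volume ≤ M

/-- `y ∈ C([0,T]; L^q) ∩ L^∞_loc((0,T); L^∞)` solves `∂_t y - Δy + f(y) = 0` on `(0,T)` in the
mild sense, and `y(0) = y₀`. Duhamel's formula is required between positive times only, where it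
makes sense for every curve in this class; nothing about the size of `f(y)` near time `0` is
presupposed, and the initial value is attained through continuity in `L^q`. -/
structure IsSolution {n : ℕ} {q : ℝ≥0∞} [Fact (1 ≤ q)] (f : ℝ → ℝ)
    (y₀ : Lp ℝ q (volume : Measure (EuclideanSpace ℝ (Fin n)))) (T : ℝ)
    (y : ℝ → Lp ℝ q (volume : Measure (EuclideanSpace ℝ (Fin n)))) : Prop where
  continuousOn : ContinuousOn y (Set.Icc 0 T)
  locallyBounded : LocallyBounded y T
  initial : y 0 = y₀
  duhamel : ∀ τ t : ℝ, 0 < τ → τ < t → t < T → Duhamel f y τ t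

end SemilinearHeat

end

/-! Put `α = n/(2q)` and measure a function at time `s` by the larger of its `L^q` norm and `s^α`
times its sup norm (`WeightedLE`). The nonlinearity costs a factor `s^{-β}` in this scale, with `β =
α(p-1)`, and `β < 1` is precisely `q > n(p-1)/2`. The heat flow from time `s` to time `t` preserves
the scale up to `2^α`, uniformly in `s < t` (`abs_heatSemigroup_sub_le`). So the Duhamel integral
meets no singularity at `s = t`, and it gains `t^{1-β}/(1-β)` (`weightedLE_duhamelIntegral`).

Existence: for small `T` the Picard map halves distances on the ball of radius `2‖y₀‖`, and its
iterates converge pointwise (`exists_mild_solution`). Each of the two norms contributes `2‖y₀‖`,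
whence the constant 4. Duhamel's formula from other starting times follows from the semigroup law
(`duhamel_restart`), and continuity in `L^q` from strong continuity of the heat flow.

Uniqueness: a competing solution has no prescribed size near time 0, so the weighted bound must
first be proved for it. Starting Duhamel's formula at `t/2`, where the solution is bounded, the
smoothing bound is propagated to `t` in small steps. The local sup bound affects only the length of
the steps, not the final constant (`ae_abs_le_of_isSolution`). Two solutions then satisfy a linear
integral inequality with kernel `s^{-β}` for the `L^q` norm of their difference; iterating it gives
bounds of the form `x^k/k!`, hence zero (`eq_of_isSolution`). -/

noncomputable section

namespace SemilinearHeat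

/-! ### Minkowski's integral inequality -/

section Minkowski

variable {S X : Type*} [MeasurableSpace S] [MeasurableSpace X] {μ : Measure S} {ν : Measure X}

/-- Hölder applied to `b h = (b h^r)^{1/r} · b^{1-1/r}`. It serves twice: for Minkowski's
inequality, and with the heat kernel as the weight `b`. -/
theorem lintegral_mul_le_rpow_mul_rpow {b h : S → ℝ≥0∞} (hb : Measurable b) (hh : Measurable h)
    {r : ℝ} (hr : 1 ≤ r) :
    ∫⁻ s, b s * h s ∂μ ≤ (∫⁻ s, b s * h s ^ r ∂μ) ^ (1 / r) * (∫⁻ s, b s ∂μ) ^ (1 - 1 / r) := by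
  have hr0 : 0 < r := by linarith
  have h1 : 0 ≤ 1 / r := by positivity
  have h2 : 0 ≤ 1 - 1 / r := by
    rw [sub_nonneg, div_le_one hr0]; exact hr
  refine le_trans (le_of_eq ?_) (ENNReal.lintegral_mul_norm_pow_le (μ := μ)
    (f := fun s => b s * h s ^ r) (g := b) (by fun_prop) (by fun_prop) h1 h2 (by ring))
  refine lintegral_congr fun s => ?_
  rw [ENNReal.mul_rpow_of_nonneg _ _ h1, ← ENNReal.rpow_mul, mul_one_div_cancel hr0.ne',
    ENNReal.rpow_one, mul_right_comm, ← ENNReal.rpow_add_of_nonneg _ _ h1 h2]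
  simp

/-- Minkowski's integral inequality. -/
theorem lintegral_rpow_lintegral_le [SFinite μ] [SFinite ν] {G : S → X → ℝ≥0∞}
    (hG : Measurable (Function.uncurry G)) {r : ℝ} (hr : 1 ≤ r) :
    ∫⁻ x, (∫⁻ s, G s x ∂μ) ^ r ∂ν ≤ (∫⁻ s, (∫⁻ x, G s x ^ r ∂ν) ^ (1 / r) ∂μ) ^ r := by
  have hr0 : 0 < r := by linarith
  set b : S → ℝ≥0∞ := fun s => (∫⁻ x, G s x ^ r ∂ν) ^ (1 / r) with hbdef
  have hbr : ∀ s, b s ^ r = ∫⁻ x, G s x ^ r ∂ν := fun s => by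
    simp only [hbdef]
    rw [← ENNReal.rpow_mul, one_div_mul_cancel hr0.ne', ENNReal.rpow_one]
  have hb : Measurable b := by
    apply Measurable.pow_const
    exact Measurable.lintegral_prod_right' (f := fun z : S × X => G z.1 z.2 ^ r)
      (hG.pow_const r)
  set B := ∫⁻ s, b s ∂μ with hB
  by_cases hBtop : B = ∞
  · rw [hBtop, ENNReal.top_rpow_of_pos hr0]; exact le_top
  have hbtop : ∀ᵐ s ∂μ, b s < ∞ := ae_lt_top hb hBtop
  have hGm : Measurable fun z : S × X => G z.1 z.2 := hG
  have hGx : ∀ x, Measurable fun s => G s x := fun x => hGm.comp measurable_prodMk_right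
  have hGs : ∀ s, Measurable (G s) := fun s => hGm.comp measurable_prodMk_left
  -- Dividing each slice by its `L^r` norm `b s` reduces the claim to slices of norm at most one.
  -- The division is harmless: `b s = ∞` only on a null set, and `b s = 0` forces the slice to
  -- vanish almost everywhere.
  have hae : ∀ᵐ x ∂ν, ∀ᵐ s ∂μ, G s x = b s * (G s x / b s) := by
    refine (Measure.ae_ae_comm (μ := μ) (ν := ν) ?_).1 ?_
    · exact measurableSet_eq_fun hGm
        ((hb.comp measurable_fst).mul (hGm.div (hb.comp measurable_fst)))
    · filter_upwards [hbtop] with s hs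
      by_cases h0 : b s = 0
      · have := hbr s
        rw [h0, ENNReal.zero_rpow_of_pos hr0, eq_comm,
          lintegral_eq_zero_iff ((hGs s).pow_const r)] at this
        filter_upwards [this] with x hx
        simp only [Pi.zero_apply, ENNReal.rpow_eq_zero_iff] at hx
        rcases hx with hx | hx
        · simp [hx.1]
        · linarith [hx.2]
      · exact Filter.Eventually.of_forall fun x => (ENNReal.mul_div_cancel h0 hs.ne).symm
  calc ∫⁻ x, (∫⁻ s, G s x ∂μ) ^ r ∂ν
      ≤ ∫⁻ x, (∫⁻ s, b s * (G s x / b s) ^ r ∂μ) * B ^ (r - 1) ∂ν := by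
        refine lintegral_mono_ae ?_
        filter_upwards [hae] with x hx
        rw [lintegral_congr_ae hx]
        refine (ENNReal.rpow_le_rpow (lintegral_mul_le_rpow_mul_rpow (μ := μ) hb
          ((hGx x).div hb) hr) hr0.le).trans (le_of_eq ?_)
        rw [ENNReal.mul_rpow_of_nonneg _ _ hr0.le, ← ENNReal.rpow_mul, ← ENNReal.rpow_mul,
          one_div_mul_cancel hr0.ne', ENNReal.rpow_one]
        congr 2
        field_simp
    _ = (∫⁻ x, ∫⁻ s, b s * (G s x / b s) ^ r ∂μ ∂ν) * B ^ (r - 1) := by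
        refine lintegral_mul_const _ ?_
        exact Measurable.lintegral_prod_left' (f := fun z : S × X => b z.1 * (G z.1 z.2 / b z.1) ^ r)
          ((hb.comp measurable_fst).mul ((hGm.div (hb.comp measurable_fst)).pow_const r))
    _ = (∫⁻ s, ∫⁻ x, b s * (G s x / b s) ^ r ∂ν ∂μ) * B ^ (r - 1) := by
        congr 1
        refine lintegral_lintegral_swap (μ := ν) (ν := μ) ?_
        exact (((hb.comp measurable_snd).mul
          (((hGm.comp measurable_swap).div (hb.comp measurable_snd)).pow_const r))).aemeasurable
    _ ≤ (∫⁻ s, b s ∂μ) * B ^ (r - 1) := by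
        gcongr with s
        rw [lintegral_const_mul _ (((hGs s).div_const _).pow_const r)]
        simp only [div_eq_mul_inv, ENNReal.mul_rpow_of_nonneg _ _ hr0.le, ENNReal.inv_rpow]
        rw [lintegral_mul_const _ ((hGs s).pow_const r), ← hbr s]
        exact mul_le_of_le_one_right' (ENNReal.mul_inv_le_one _)
    _ = B ^ r := by
        conv_lhs => rw [← hB, ← ENNReal.rpow_one B, ← ENNReal.rpow_mul, one_mul]
        rw [← ENNReal.rpow_add_of_nonneg _ _ zero_le_one (by linarith)]
        congr 1; ring

theorem eLpNorm_integral_le_lintegral [SFinite μ] [SFinite ν] {q : ℝ≥0∞} (hq1 : 1 ≤ q)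
    (hq : q ≠ ∞) {g : S → X → ℝ} (hg : Measurable (Function.uncurry g)) :
    eLpNorm (fun x => ∫ s, g s x ∂μ) q ν ≤ ∫⁻ s, eLpNorm (g s) q ν ∂μ := by
  have hq0 : q ≠ 0 := (zero_lt_one.trans_le hq1).ne'
  have hr : 1 ≤ q.toReal := by
    simpa using (ENNReal.toReal_le_toReal ENNReal.one_ne_top hq).2 hq1
  simp only [eLpNorm_eq_lintegral_rpow_enorm_toReal hq0 hq]
  rw [one_div, ENNReal.rpow_inv_le_iff (by linarith), ← one_div]
  refine le_trans (lintegral_mono fun x => ?_) (lintegral_rpow_lintegral_le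
    (G := fun s x => ‖g s x‖ₑ) hg.enorm hr)
  gcongr
  exact enorm_integral_le_lintegral_enorm _

end Minkowski

/-! ### The heat kernel: mass, sup bound, convolution -/

section Kernel

variable {n : ℕ}

theorem heatKernel_nonneg {t : ℝ} (ht : 0 ≤ t) (x : EuclideanSpace ℝ (Fin n)) :
    0 ≤ heatKernel n t x := by
  unfold heatKernel; positivity

theorem measurable_heatKernel :
    Measurable fun z : ℝ × EuclideanSpace ℝ (Fin n) => heatKernel n z.1 z.2 := by
  unfold heatKernel; fun_prop

theorem measurable_heatKernel_right (t : ℝ) : Measurable (heatKernel n t) := by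
  unfold heatKernel; fun_prop

theorem heatKernel_le {t : ℝ} (ht : 0 < t) (x : EuclideanSpace ℝ (Fin n)) :
    heatKernel n t x ≤ t ^ (-((n : ℝ) / 2)) := by
  unfold heatKernel
  have h1 : (4 * Real.pi * t) ^ (-((n : ℝ) / 2)) ≤ t ^ (-((n : ℝ) / 2)) := by
    refine Real.rpow_le_rpow_of_nonpos ht ?_ (by have : (0:ℝ) ≤ n := n.cast_nonneg; linarith)
    nlinarith [Real.pi_gt_three]
  have h2 : Real.exp (-(‖x‖ ^ 2) / (4 * t)) ≤ 1 := by
    rw [Real.exp_le_one_iff]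
    exact div_nonpos_of_nonpos_of_nonneg (by nlinarith [sq_nonneg ‖x‖]) (by positivity)
  calc _ ≤ (4 * Real.pi * t) ^ (-((n : ℝ) / 2)) * 1 := by gcongr
    _ ≤ _ := by simpa using h1

theorem integral_exp_neg_mul_sq_norm {b : ℝ} (hb : 0 < b) :
    ∫ v : EuclideanSpace ℝ (Fin n), Real.exp (-b * ‖v‖ ^ 2) = (Real.pi / b) ^ ((n : ℝ) / 2) := by
  simpa using GaussianFourier.integral_rexp_neg_mul_sq_norm (V := EuclideanSpace ℝ (Fin n)) hb

theorem integral_heatKernel {t : ℝ} (ht : 0 < t) : ∫ x, heatKernel n t x = 1 := by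
  unfold heatKernel
  rw [integral_const_mul]
  have := integral_exp_neg_mul_sq_norm (n := n) (b := 1 / (4 * t)) (by positivity)
  have h2 : (fun v : EuclideanSpace ℝ (Fin n) => Real.exp (-(1 / (4 * t)) * ‖v‖ ^ 2))
      = fun v => Real.exp (-‖v‖ ^ 2 / (4 * t)) := by
    ext v; congr 1; ring
  rw [h2] at this
  rw [this, Real.rpow_neg (by positivity)]
  have : Real.pi / (1 / (4 * t)) = 4 * Real.pi * t := by field_simp
  rw [this, inv_mul_cancel₀]
  positivity

theorem integrable_heatKernel {t : ℝ} (ht : 0 < t) : Integrable (heatKernel n t) := by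
  -- A non-integrable function has integral 0 by convention, while the integral here is 1.
  by_contra h
  have := integral_undef h
  rw [integral_heatKernel ht] at this
  exact one_ne_zero this

theorem lintegral_heatKernel {t : ℝ} (ht : 0 < t) :
    ∫⁻ x, ‖heatKernel n t x‖ₑ = 1 := by
  have := ofReal_integral_eq_lintegral_ofReal (integrable_heatKernel (n := n) ht)
    (Filter.Eventually.of_forall fun x => heatKernel_nonneg ht.le x)
  rw [integral_heatKernel ht, ENNReal.ofReal_one] at this
  rw [this]
  exact lintegral_congr fun x => Real.enorm_of_nonneg (heatKernel_nonneg ht.le x)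

theorem lintegral_heatKernel_sub {t : ℝ} (ht : 0 < t) (x : EuclideanSpace ℝ (Fin n)) :
    ∫⁻ z, ‖heatKernel n t (x - z)‖ₑ = 1 := by
  rw [lintegral_sub_left_eq_self (fun z => ‖heatKernel n t z‖ₑ) x, lintegral_heatKernel ht]

/-- Completing the square: as a function of `z` the product is a constant times a heat kernel at
time `st/(s+t)`, centred at a weighted mean of `x` and `w`. -/
theorem integral_heatKernel_mul_heatKernel {s t : ℝ} (hs : 0 < s) (ht : 0 < t)
    (x w : EuclideanSpace ℝ (Fin n)) :
    ∫ z, heatKernel n s (x - z) * heatKernel n t (z - w) = heatKernel n (s + t) (x - w) := by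
  have key : ∀ z : EuclideanSpace ℝ (Fin n),
      heatKernel n s (x - z) * heatKernel n t (z - w) = heatKernel n (s + t) (x - w) *
        heatKernel n (s * t / (s + t)) (z - ((t / (s + t)) • x + (s / (s + t)) • w)) := by
    intro z
    unfold heatKernel
    rw [mul_mul_mul_comm, mul_mul_mul_comm (_ ^ _) (Real.exp _) (_ ^ _) (Real.exp _), ← Real.exp_add, ← Real.exp_add,
      ← Real.mul_rpow (by positivity) (by positivity),
      ← Real.mul_rpow (by positivity) (by positivity)]
    congr 2
    · field_simp
    · have h1 : ‖x - z‖ ^ 2 = ‖x‖ ^ 2 - 2 * inner ℝ x z + ‖z‖ ^ 2 := norm_sub_sq_real _ _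
      have h2 : ‖z - w‖ ^ 2 = ‖z‖ ^ 2 - 2 * inner ℝ z w + ‖w‖ ^ 2 := norm_sub_sq_real _ _
      have h3 : ‖x - w‖ ^ 2 = ‖x‖ ^ 2 - 2 * inner ℝ x w + ‖w‖ ^ 2 := norm_sub_sq_real _ _
      have h4 : ‖z - ((t / (s + t)) • x + (s / (s + t)) • w)‖ ^ 2 = ‖z‖ ^ 2
          - 2 * ((t / (s + t)) * inner ℝ x z + (s / (s + t)) * inner ℝ z w)
          + ((t / (s + t)) ^ 2 * ‖x‖ ^ 2 + 2 * ((t / (s + t)) * (s / (s + t)) * inner ℝ x w)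
            + (s / (s + t)) ^ 2 * ‖w‖ ^ 2) := by
        rw [norm_sub_sq_real, norm_add_sq_real, inner_add_right, inner_smul_right,
          inner_smul_right, inner_smul_left, inner_smul_right, norm_smul, norm_smul,
          Real.norm_of_nonneg (by positivity), Real.norm_of_nonneg (by positivity),
          real_inner_comm x z]
        simp only [conj_trivial]
        ring
      rw [h1, h2, h3, h4]
      field_simp
      ring
  simp_rw [key]
  rw [integral_const_mul,
    integral_sub_right_eq_self (fun z => heatKernel n (s * t / (s + t)) z), integral_heatKernel
      (by positivity), mul_one]

end Kernel

/-! ### Smoothing estimates and algebra of the heat semigroup -/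

section Semigroup

variable {n : ℕ} {q : ℝ≥0∞}

theorem toReal_pos_of_one_le (hq1 : 1 ≤ q) (hq : q ≠ ∞) : 0 < q.toReal :=
  ENNReal.toReal_pos (zero_lt_one.trans_le hq1).ne' hq

/-- Hölder against the kernel, which has mass one, followed by the sup bound `t^{-n/2}`, of which
the power `1/q` survives. The estimate holds at every point, so later arguments can work with
functions rather than classes. -/
theorem lintegral_heatKernel_mul_le (hq1 : 1 ≤ q) (hq : q ≠ ∞) {t : ℝ} (ht : 0 < t)
    {φ : EuclideanSpace ℝ (Fin n) → ℝ} (hφ : Measurable φ) (x : EuclideanSpace ℝ (Fin n)) :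
    ∫⁻ z, ‖heatKernel n t (x - z) * φ z‖ₑ ≤
      ENNReal.ofReal (t ^ (-((n : ℝ) / (2 * q.toReal)))) * eLpNorm φ q volume := by
  have hr0 := toReal_pos_of_one_le hq1 hq
  have hr : 1 ≤ q.toReal := by
    simpa using (ENNReal.toReal_le_toReal ENNReal.one_ne_top hq).2 hq1
  have hK : Measurable fun z => ‖heatKernel n t (x - z)‖ₑ :=
    ((measurable_heatKernel_right t).comp (measurable_const.sub measurable_id)).enorm
  simp only [enorm_mul]
  refine (lintegral_mul_le_rpow_mul_rpow hK hφ.enorm hr).trans ?_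
  rw [lintegral_heatKernel_sub ht, ENNReal.one_rpow, mul_one,
    eLpNorm_eq_lintegral_rpow_enorm_toReal (zero_lt_one.trans_le hq1).ne' hq]
  have h1 : ∀ z, ‖heatKernel n t (x - z)‖ₑ ≤ ENNReal.ofReal (t ^ (-((n : ℝ) / 2))) := fun z => by
    rw [Real.enorm_of_nonneg (heatKernel_nonneg ht.le _)]
    exact ENNReal.ofReal_le_ofReal (heatKernel_le ht _)
  have h2 : ENNReal.ofReal (t ^ (-((n : ℝ) / (2 * q.toReal)))) =
      ENNReal.ofReal (t ^ (-((n : ℝ) / 2))) ^ (1 / q.toReal) := by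
    rw [ENNReal.ofReal_rpow_of_nonneg (by positivity) (by positivity), ← Real.rpow_mul ht.le]
    congr 2; field_simp
  rw [h2, ← ENNReal.mul_rpow_of_nonneg _ _ (by positivity),
    ← lintegral_const_mul _ (hφ.enorm.pow_const _)]
  gcongr with z
  exact h1 z

theorem integrable_heatKernel_mul (hq1 : 1 ≤ q) (hq : q ≠ ∞) {t : ℝ} (ht : 0 < t)
    {φ : EuclideanSpace ℝ (Fin n) → ℝ} (hφ : Measurable φ) (hφq : eLpNorm φ q volume ≠ ∞)
    (x : EuclideanSpace ℝ (Fin n)) : Integrable fun z => heatKernel n t (x - z) * φ z := by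
  refine ⟨(((measurable_heatKernel_right t).comp (measurable_const.sub measurable_id)).mul
    hφ).aestronglyMeasurable, ?_⟩
  refine (lintegral_heatKernel_mul_le hq1 hq ht hφ x).trans_lt ?_
  exact ENNReal.mul_lt_top ENNReal.ofReal_lt_top hφq.lt_top

theorem enorm_heatSemigroup_le (hq1 : 1 ≤ q) (hq : q ≠ ∞) {t : ℝ} (ht : 0 < t)
    {φ : EuclideanSpace ℝ (Fin n) → ℝ} (hφ : Measurable φ) (x : EuclideanSpace ℝ (Fin n)) :
    ‖heatSemigroup t φ x‖ₑ ≤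
      ENNReal.ofReal (t ^ (-((n : ℝ) / (2 * q.toReal)))) * eLpNorm φ q volume :=
  (enorm_integral_le_lintegral_enorm _).trans (lintegral_heatKernel_mul_le hq1 hq ht hφ x)

theorem abs_heatSemigroup_le (hq1 : 1 ≤ q) (hq : q ≠ ∞) {t A : ℝ} (ht : 0 < t) (hA : 0 ≤ A)
    {φ : EuclideanSpace ℝ (Fin n) → ℝ} (hφ : Measurable φ)
    (hφA : eLpNorm φ q volume ≤ ENNReal.ofReal A) (x : EuclideanSpace ℝ (Fin n)) :
    |heatSemigroup t φ x| ≤ A * t ^ (-((n : ℝ) / (2 * q.toReal))) := by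
  have h := (enorm_heatSemigroup_le hq1 hq ht hφ x).trans (mul_le_mul_right hφA _)
  rw [← ENNReal.ofReal_mul (by positivity), Real.enorm_eq_ofReal_abs,
    ENNReal.ofReal_le_ofReal_iff (by positivity)] at h
  linarith

theorem abs_heatSemigroup_le_of_bound {t B : ℝ} (ht : 0 < t)
    {φ : EuclideanSpace ℝ (Fin n) → ℝ} (hφ : ∀ᵐ z, |φ z| ≤ B) (x : EuclideanSpace ℝ (Fin n)) :
    |heatSemigroup t φ x| ≤ B := by
  have hint : Integrable fun z => heatKernel n t (x - z) * B :=
    ((integrable_heatKernel ht).comp_sub_left x).mul_const B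
  have h : ‖heatSemigroup t φ x‖ ≤ ∫ z, heatKernel n t (x - z) * B := by
    refine norm_integral_le_of_norm_le hint ?_
    filter_upwards [hφ] with z hz
    rw [norm_mul, Real.norm_of_nonneg (heatKernel_nonneg ht.le _)]
    exact mul_le_mul_of_nonneg_left hz (heatKernel_nonneg ht.le _)
  rw [integral_mul_const, integral_sub_left_eq_self (fun z => heatKernel n t z),
    integral_heatKernel ht, one_mul] at h
  exact h

/-- The smoothing estimate between the weighted norms `max (‖g‖_q, s^α ‖g‖_∞)` at the times
`s < t`, where `α = n / (2 q)`. -/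
theorem abs_heatSemigroup_sub_le (hq1 : 1 ≤ q) (hq : q ≠ ∞) {s t A : ℝ} (hs : 0 < s)
    (hst : s < t) (hA : 0 ≤ A) {φ : EuclideanSpace ℝ (Fin n) → ℝ} (hφ : Measurable φ)
    (hφA : eLpNorm φ q volume ≤ ENNReal.ofReal A)
    (hφB : ∀ᵐ z, |φ z| ≤ A * s ^ (-((n : ℝ) / (2 * q.toReal)))) (x : EuclideanSpace ℝ (Fin n)) :
    |heatSemigroup (t - s) φ x| ≤
      A * (2 ^ ((n : ℝ) / (2 * q.toReal)) * t ^ (-((n : ℝ) / (2 * q.toReal)))) := by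
  have hr0 := toReal_pos_of_one_le hq1 hq
  set α := (n : ℝ) / (2 * q.toReal) with hα
  have hα0 : 0 ≤ α := by positivity
  have ht : 0 < t := hs.trans hst
  have h2 : (2 : ℝ) ^ α * t ^ (-α) = (t / 2) ^ (-α) := by
    rw [Real.div_rpow ht.le (by norm_num), Real.rpow_neg (by norm_num : (0:ℝ) ≤ 2)]
    field_simp
  rw [h2]
  -- For `s ≤ t/2` the flow has run for at least `t/2` and smooths from `L^q`; for `s ≥ t/2` the sup
  -- bound already held at time `s` is enough.
  rcases le_total s (t / 2) with h | h
  · refine (abs_heatSemigroup_le hq1 hq (by linarith) hA hφ hφA x).trans ?_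
    gcongr 1
    exact Real.rpow_le_rpow_of_nonpos (by linarith) (by linarith) (by linarith)
  · refine (abs_heatSemigroup_le_of_bound (by linarith) hφB x).trans ?_
    gcongr 1
    exact Real.rpow_le_rpow_of_nonpos (by linarith) (by linarith) (by linarith)

theorem heatSemigroup_eq_integral_sub (t : ℝ) (φ : EuclideanSpace ℝ (Fin n) → ℝ)
    (x : EuclideanSpace ℝ (Fin n)) :
    heatSemigroup t φ x = ∫ z, heatKernel n t z * φ (x - z) := by
  unfold heatSemigroup
  rw [← integral_sub_left_eq_self (fun z => heatKernel n t z * φ (x - z)) volume x]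
  simp

theorem eLpNorm_comp_sub_right {φ : EuclideanSpace ℝ (Fin n) → ℝ} (hφ : Measurable φ)
    (z : EuclideanSpace ℝ (Fin n)) :
    eLpNorm (fun x => φ (x - z)) q volume = eLpNorm φ q volume :=
  eLpNorm_comp_measurePreserving (g := φ) hφ.aestronglyMeasurable
    (measurePreserving_sub_right volume z)

/-- The heat flow is an average of translates against a kernel of mass one, so Minkowski's
inequality applies. -/
theorem eLpNorm_heatSemigroup_le (hq1 : 1 ≤ q) (hq : q ≠ ∞) {t : ℝ} (ht : 0 < t)
    {φ : EuclideanSpace ℝ (Fin n) → ℝ} (hφ : Measurable φ) :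
    eLpNorm (heatSemigroup t φ) q volume ≤ eLpNorm φ q volume := by
  have h : heatSemigroup t φ = fun x => ∫ z, heatKernel n t z * φ (x - z) :=
    funext (heatSemigroup_eq_integral_sub t φ)
  rw [h]
  refine (eLpNorm_integral_le_lintegral hq1 hq (g := fun z x => heatKernel n t z * φ (x - z))
    ?_).trans ?_
  · exact ((measurable_heatKernel_right t).comp measurable_fst).mul
      (hφ.comp (measurable_snd.sub measurable_fst))
  · have : ∀ z, eLpNorm (fun x => heatKernel n t z * φ (x - z)) q volume =
        ‖heatKernel n t z‖ₑ * eLpNorm φ q volume := fun z => by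
      rw [← eLpNorm_comp_sub_right hφ z]
      exact eLpNorm_const_smul (heatKernel n t z) (fun x => φ (x - z)) q volume
    simp only [this]
    rw [lintegral_mul_const _ (measurable_heatKernel_right t).enorm, lintegral_heatKernel ht,
      one_mul]

theorem measurable_heatSemigroup_uncurry {S : Type*} [MeasurableSpace S]
    {τ : S → ℝ} (hτ : Measurable τ)
    {g : S → EuclideanSpace ℝ (Fin n) → ℝ} (hg : Measurable (Function.uncurry g)) :
    Measurable fun p : S × EuclideanSpace ℝ (Fin n) => heatSemigroup (τ p.1) (g p.1) p.2 := by
  refine StronglyMeasurable.measurable ?_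
  refine StronglyMeasurable.integral_prod_right'
    (f := fun w : (S × EuclideanSpace ℝ (Fin n)) × EuclideanSpace ℝ (Fin n) =>
      heatKernel n (τ w.1.1) (w.1.2 - w.2) * g w.1.1 w.2) ?_
  refine Measurable.stronglyMeasurable (Measurable.mul ?_ ?_)
  · exact measurable_heatKernel.comp ((hτ.comp (measurable_fst.comp measurable_fst)).prodMk
      ((measurable_snd.comp measurable_fst).sub measurable_snd))
  · exact hg.comp ((measurable_fst.comp measurable_fst).prodMk measurable_snd)

theorem measurable_heatSemigroup (t : ℝ) {φ : EuclideanSpace ℝ (Fin n) → ℝ} (hφ : Measurable φ) :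
    Measurable (heatSemigroup t φ) :=
  (measurable_heatSemigroup_uncurry (S := Unit) (τ := fun _ => t) measurable_const
    (g := fun _ => φ) (hφ.comp measurable_snd)).comp (measurable_const.prodMk measurable_id)
    (g := fun p : Unit × EuclideanSpace ℝ (Fin n) => heatSemigroup t φ p.2) (f := fun x => ((), x))

theorem heatSemigroup_congr_ae {φ ψ : EuclideanSpace ℝ (Fin n) → ℝ} (h : φ =ᵐ[volume] ψ) (t : ℝ) :
    heatSemigroup t φ = heatSemigroup t ψ := by
  ext x
  refine integral_congr_ae ?_
  filter_upwards [h] with z hz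
  rw [hz]

theorem heatSemigroup_sub (hq1 : 1 ≤ q) (hq : q ≠ ∞) {t : ℝ} (ht : 0 < t)
    {φ ψ : EuclideanSpace ℝ (Fin n) → ℝ} (hφ : Measurable φ) (hφq : eLpNorm φ q volume ≠ ∞)
    (hψ : Measurable ψ) (hψq : eLpNorm ψ q volume ≠ ∞) (x : EuclideanSpace ℝ (Fin n)) :
    heatSemigroup t (fun z => φ z - ψ z) x = heatSemigroup t φ x - heatSemigroup t ψ x := by
  unfold heatSemigroup
  simp only [mul_sub]
  exact integral_sub (integrable_heatKernel_mul hq1 hq ht hφ hφq x)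
    (integrable_heatKernel_mul hq1 hq ht hψ hψq x)

/-- The heat semigroup commutes with integrals over a parameter. -/
theorem heatSemigroup_integral (hq1 : 1 ≤ q) (hq : q ≠ ∞) {S : Type*} [MeasurableSpace S]
    {μ : Measure S} [SFinite μ] {t : ℝ} (ht : 0 < t)
    {g : S → EuclideanSpace ℝ (Fin n) → ℝ} (hg : Measurable (Function.uncurry g))
    (hgq : ∫⁻ s, eLpNorm (g s) q volume ∂μ ≠ ∞) (x : EuclideanSpace ℝ (Fin n)) :
    heatSemigroup t (fun z => ∫ s, g s z ∂μ) x = ∫ s, heatSemigroup t (g s) x ∂μ := by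
  unfold heatSemigroup
  simp only [← integral_const_mul]
  have hgm : Measurable fun w : S × EuclideanSpace ℝ (Fin n) => g w.1 w.2 := hg
  have hm : Measurable fun w : S × EuclideanSpace ℝ (Fin n) =>
      heatKernel n t (x - w.2) * g w.1 w.2 :=
    ((measurable_heatKernel_right t).comp (measurable_const.sub measurable_snd)).mul hgm
  refine integral_integral_swap
    (f := fun z s => heatKernel n t (x - z) * g s z) ?_
  refine Integrable.swap (f := fun w : S × EuclideanSpace ℝ (Fin n) =>
      heatKernel n t (x - w.2) * g w.1 w.2) ?_
  refine ⟨hm.aestronglyMeasurable, ?_⟩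
  unfold HasFiniteIntegral
  rw [lintegral_prod _ hm.enorm.aemeasurable]
  refine (lintegral_mono fun s => lintegral_heatKernel_mul_le hq1 hq ht
    (hgm.comp measurable_prodMk_left : Measurable (g s)) x).trans_lt ?_
  rw [lintegral_const_mul' _ _ ENNReal.ofReal_ne_top]
  exact ENNReal.mul_lt_top ENNReal.ofReal_lt_top hgq.lt_top

theorem heatSemigroup_heatSemigroup (hq1 : 1 ≤ q) (hq : q ≠ ∞) {s t : ℝ} (hs : 0 < s)
    (ht : 0 < t) {φ : EuclideanSpace ℝ (Fin n) → ℝ} (hφ : Measurable φ)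
    (hφq : eLpNorm φ q volume ≠ ∞) (x : EuclideanSpace ℝ (Fin n)) :
    heatSemigroup s (heatSemigroup t φ) x = heatSemigroup (s + t) φ x := by
  unfold heatSemigroup
  simp only [← integral_const_mul]
  have hKs : Measurable fun w : EuclideanSpace ℝ (Fin n) => heatKernel n s (x - w) :=
    (measurable_heatKernel_right s).comp (measurable_const.sub measurable_id)
  have hm : Measurable fun w : EuclideanSpace ℝ (Fin n) × EuclideanSpace ℝ (Fin n) =>
      heatKernel n s (x - w.1) * (heatKernel n t (w.1 - w.2) * φ w.2) :=
    (hKs.comp measurable_fst).mul (((measurable_heatKernel_right t).comp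
      (measurable_fst.sub measurable_snd)).mul (hφ.comp measurable_snd))
  rw [integral_integral_swap (f := fun z w => heatKernel n s (x - z) *
    (heatKernel n t (z - w) * φ w))]
  · refine integral_congr_ae (Filter.Eventually.of_forall fun w => ?_)
    simp only [← mul_assoc]
    rw [integral_mul_const, integral_heatKernel_mul_heatKernel hs ht]
  · refine ⟨hm.aestronglyMeasurable, ?_⟩
    simp only [HasFiniteIntegral, Function.uncurry]
    rw [lintegral_prod _ hm.enorm.aemeasurable]
    simp only [enorm_mul]
    refine (lintegral_mono (g := fun z => ‖heatKernel n s (x - z)‖ₑ *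
      (ENNReal.ofReal (t ^ (-((n : ℝ) / (2 * q.toReal)))) * eLpNorm φ q volume)) fun z => ?_).trans_lt
        ?_
    · rw [lintegral_const_mul' _ _ enorm_ne_top]
      refine mul_le_mul' le_rfl ?_
      simpa only [enorm_mul] using lintegral_heatKernel_mul_le hq1 hq ht hφ z
    · rw [lintegral_mul_const _ hKs.enorm, lintegral_heatKernel_sub hs, one_mul]
      exact ENNReal.mul_lt_top ENNReal.ofReal_lt_top hφq.lt_top

end Semigroup

/-! ### Strong continuity of the heat flow in `L^q` -/

section StrongContinuity

open Filter Topology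

variable {n : ℕ} {q : ℝ≥0∞}

theorem continuous_edist_translate (hq1 : 1 ≤ q) (hq : q ≠ ∞)
    {φ : EuclideanSpace ℝ (Fin n) → ℝ} (hφ : MemLp φ q volume) :
    Continuous fun w : EuclideanSpace ℝ (Fin n) × EuclideanSpace ℝ (Fin n) =>
      eLpNorm (fun x => φ (x - w.1) - φ (x - w.2)) q volume := by
  have : Fact (1 ≤ q) := ⟨hq1⟩
  let g : C(EuclideanSpace ℝ (Fin n), C(EuclideanSpace ℝ (Fin n), EuclideanSpace ℝ (Fin n))) :=
    (ContinuousMap.mk (fun a : EuclideanSpace ℝ (Fin n) × EuclideanSpace ℝ (Fin n) =>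
      a.2 - a.1) (by fun_prop)).curry
  have hg : ∀ w, MeasurePreserving (g w) volume volume :=
    fun w => measurePreserving_sub_right volume w
  have hc : Continuous fun w => Lp.compMeasurePreserving (g w) (hg w) (hφ.toLp φ) :=
    (continuous_const (y := hφ.toLp φ)).compMeasurePreservingLp g.continuous hg hq
  have h2 := (hc.comp continuous_fst).edist (hc.comp continuous_snd)
  refine h2.congr fun w => ?_
  simp only [Function.comp_apply, Lp.toLp_compMeasurePreserving, Lp.edist_toLp_toLp]
  rfl

/-- `heatSemigroup r φ` written as an average of translates against the kernel at time one. -/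
def heatAverage (r : ℝ) (φ : EuclideanSpace ℝ (Fin n) → ℝ) (x : EuclideanSpace ℝ (Fin n)) : ℝ :=
  ∫ z, heatKernel n 1 z * φ (x - √r • z)

/-- The reason for the rescaled form: for `n ≥ 1` the kernel at time 0 vanishes by convention,
whereas the average of translates reaches the identity continuously. -/
theorem heatAverage_zero (φ : EuclideanSpace ℝ (Fin n) → ℝ) : heatAverage 0 φ = φ := by
  ext x
  simp [heatAverage, integral_mul_const, integral_heatKernel]

theorem heatKernel_one_eq {r : ℝ} (hr : 0 < r) (z : EuclideanSpace ℝ (Fin n)) :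
    heatKernel n 1 z = √r ^ n * heatKernel n r (√r • z) := by
  have hs : 0 < √r := Real.sqrt_pos.2 hr
  unfold heatKernel
  rw [norm_smul, mul_pow, Real.norm_of_nonneg hs.le, Real.sq_sqrt hr.le,
    Real.mul_rpow (x := 4 * Real.pi) (y := r) (by positivity) hr.le]
  have h1 : √r ^ n * r ^ (-((n : ℝ) / 2)) = 1 := by
    rw [Real.sqrt_eq_rpow, ← Real.rpow_natCast, ← Real.rpow_mul hr.le, ← Real.rpow_add hr]
    ring_nf
    simp
  have h2 : -(r * ‖z‖ ^ 2) / (4 * r) = -‖z‖ ^ 2 / (4 * 1) := by field_simp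
  rw [h2, mul_one]
  linear_combination -((4 * Real.pi) ^ (-((n : ℝ) / 2)) * Real.exp (-‖z‖ ^ 2 / (4 * 1))) * h1

theorem heatAverage_of_pos {r : ℝ} (hr : 0 < r) (φ : EuclideanSpace ℝ (Fin n) → ℝ) :
    heatAverage r φ = heatSemigroup r φ := by
  ext x
  rw [heatSemigroup_eq_integral_sub]
  have hs : 0 < √r := Real.sqrt_pos.2 hr
  have h := Measure.integral_comp_smul (volume : Measure (EuclideanSpace ℝ (Fin n)))
    (fun z => heatKernel n r z * φ (x - z)) (√r)
  rw [finrank_euclideanSpace_fin, abs_of_pos (by positivity), smul_eq_mul, eq_inv_mul_iff_mul_eq₀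
    (by positivity)] at h
  rw [← h, ← integral_const_mul]
  refine integral_congr_ae (Eventually.of_forall fun z => ?_)
  simp only [heatKernel_one_eq hr z, mul_assoc]

theorem integrable_heatKernel_one_mul (hq1 : 1 ≤ q) (hq : q ≠ ∞)
    {φ : EuclideanSpace ℝ (Fin n) → ℝ} (hφ : Measurable φ) (hφq : eLpNorm φ q volume ≠ ∞) (r : ℝ)
    (x : EuclideanSpace ℝ (Fin n)) : Integrable fun z => heatKernel n 1 z * φ (x - √r • z) := by
  rcases le_or_gt r 0 with hr | hr
  · simpa [Real.sqrt_eq_zero_of_nonpos hr] using (integrable_heatKernel one_pos).mul_const (φ x)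
  · have h := ((integrable_heatKernel_mul hq1 hq hr hφ hφq x).comp_sub_left x).comp_smul
      (Real.sqrt_pos.2 hr).ne'
    simpa only [heatKernel_one_eq hr, mul_assoc, sub_sub_cancel] using h.const_mul (√r ^ n)

/-- Minkowski's inequality bounds the difference by an average of `L^q` distances between
translates. These tend to 0 and are dominated by `2‖φ‖_q`. -/
theorem tendsto_eLpNorm_heatAverage_sub (hq1 : 1 ≤ q) (hq : q ≠ ∞)
    {φ : EuclideanSpace ℝ (Fin n) → ℝ} (hφ : Measurable φ) (hφq : eLpNorm φ q volume ≠ ∞) (r₀ : ℝ) :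
    Tendsto (fun r => eLpNorm (fun x => heatAverage r φ x - heatAverage r₀ φ x) q volume)
      (𝓝 r₀) (𝓝 0) := by
  have hmem : MemLp φ q volume := ⟨hφ.aestronglyMeasurable, hφq.lt_top⟩
  have hc := continuous_edist_translate hq1 hq hmem
  have hK := measurable_heatKernel_right (n := n) 1
  have hbound : ∀ w w' : EuclideanSpace ℝ (Fin n),
      eLpNorm (fun x => φ (x - w) - φ (x - w')) q volume ≤ 2 * eLpNorm φ q volume := by
    intro w w'
    refine (eLpNorm_sub_le (f := fun x => φ (x - w)) (g := fun x => φ (x - w'))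
      (hφ.comp (measurable_id.sub_const w)).aestronglyMeasurable
      (hφ.comp (measurable_id.sub_const w')).aestronglyMeasurable hq1).trans ?_
    rw [eLpNorm_comp_sub_right hφ, eLpNorm_comp_sub_right hφ, two_mul]
  have hle : ∀ r, eLpNorm (fun x => heatAverage r φ x - heatAverage r₀ φ x) q volume ≤
      ∫⁻ z, ‖heatKernel n 1 z‖ₑ *
        eLpNorm (fun x => φ (x - √r • z) - φ (x - √r₀ • z)) q volume := by
    intro r
    have h1 : (fun x => heatAverage r φ x - heatAverage r₀ φ x) = fun x =>
        ∫ z, heatKernel n 1 z * (φ (x - √r • z) - φ (x - √r₀ • z)) := by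
      ext x
      simp only [mul_sub]
      exact (integral_sub (integrable_heatKernel_one_mul hq1 hq hφ hφq r x)
        (integrable_heatKernel_one_mul hq1 hq hφ hφq r₀ x)).symm
    rw [h1]
    refine (eLpNorm_integral_le_lintegral hq1 hq (g := fun z x =>
      heatKernel n 1 z * (φ (x - √r • z) - φ (x - √r₀ • z))) ?_).trans (le_of_eq ?_)
    · have hm : Measurable fun w : EuclideanSpace ℝ (Fin n) × EuclideanSpace ℝ (Fin n) =>
          heatKernel n 1 w.1 * (φ (w.2 - √r • w.1) - φ (w.2 - √r₀ • w.1)) := by fun_prop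
      exact hm
    · exact lintegral_congr fun z => eLpNorm_const_smul (heatKernel n 1 z)
        (fun x => φ (x - √r • z) - φ (x - √r₀ • z)) q volume
  refine tendsto_of_tendsto_of_tendsto_of_le_of_le tendsto_const_nhds ?_ (fun _ => bot_le) hle
  have h0 : ∫⁻ z : EuclideanSpace ℝ (Fin n), ‖heatKernel n 1 z‖ₑ * 0 = 0 := by simp
  rw [← h0]
  refine tendsto_lintegral_filter_of_dominated_convergence
    (fun z => ‖heatKernel n 1 z‖ₑ * (2 * eLpNorm φ q volume)) ?_ ?_ ?_ ?_
  · refine Eventually.of_forall fun r => ?_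
    exact hK.enorm.mul (hc.comp (by fun_prop : Continuous fun z : EuclideanSpace ℝ (Fin n) =>
      (√r • z, √r₀ • z))).measurable
  · exact Eventually.of_forall fun r => Eventually.of_forall fun z =>
      mul_le_mul' le_rfl (hbound _ _)
  · rw [lintegral_mul_const _ hK.enorm, lintegral_heatKernel one_pos, one_mul]
    exact ENNReal.mul_ne_top (by simp) hφq
  · refine Eventually.of_forall fun z => ?_
    refine ENNReal.Tendsto.const_mul ?_ (Or.inr enorm_ne_top)
    have := (hc.comp (by fun_prop : Continuous fun r : ℝ => (√r • z, √r₀ • z))).tendsto r₀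
    simpa [Function.comp_def] using this

end StrongContinuity

/-! ### Local Lipschitz bounds for the nonlinearity -/

section Nonlinearity

theorem abs_sub_le_of_growth {p : ℝ} (hp : 1 < p) {f : ℝ → ℝ} {K : ℝ} (hK : 0 < K)
    (hf : ∀ a b : ℝ, |f a - f b| ≤ K * (|a| ^ (p - 1) + |b| ^ (p - 1)) * |a - b|)
    {a b B : ℝ} (ha : |a| ≤ B) (hb : |b| ≤ B) :
    |f a - f b| ≤ 2 * K * B ^ (p - 1) * |a - b| := by
  refine (hf a b).trans ?_
  have h1 : |a| ^ (p - 1) ≤ B ^ (p - 1) :=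
    Real.rpow_le_rpow (abs_nonneg _) ha (by linarith)
  have h2 : |b| ^ (p - 1) ≤ B ^ (p - 1) :=
    Real.rpow_le_rpow (abs_nonneg _) hb (by linarith)
  have : K * (|a| ^ (p - 1) + |b| ^ (p - 1)) ≤ 2 * K * B ^ (p - 1) := by nlinarith
  gcongr

theorem mul_rpow_neg_rpow {M s α p : ℝ} (hM : 0 ≤ M) (hs : 0 < s) :
    (M * s ^ (-α)) ^ (p - 1) = M ^ (p - 1) * s ^ (-(α * (p - 1))) := by
  rw [Real.mul_rpow hM (by positivity), ← Real.rpow_mul hs.le, neg_mul]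

end Nonlinearity

/-! ### Integrals of `s^{-β}` with `β < 1` -/

section PowerIntegral

theorem integrableOn_mul_rpow_neg {β : ℝ} (hβ : β < 1) (A a t : ℝ) (hat : a ≤ t) :
    IntegrableOn (fun s => A * s ^ (-β)) (Set.Ioc a t) := by
  have := (intervalIntegral.intervalIntegrable_rpow' (a := a) (b := t)
    (by linarith : -1 < -β)).const_mul A
  exact (intervalIntegrable_iff_integrableOn_Ioc_of_le hat).1 this

theorem integral_mul_rpow_neg {β : ℝ} (hβ : β < 1) (A : ℝ) {a t : ℝ} (hat : a ≤ t) :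
    ∫ s in Set.Ioc a t, A * s ^ (-β) = A * ((t ^ (1 - β) - a ^ (1 - β)) / (1 - β)) := by
  rw [← intervalIntegral.integral_of_le hat, intervalIntegral.integral_const_mul,
    integral_rpow (Or.inl (by linarith))]
  congr 2 <;> ring_nf

theorem lintegral_mul_rpow_neg {β : ℝ} (hβ : β < 1) {A : ℝ} (hA : 0 ≤ A) {a t : ℝ} (ha : 0 ≤ a)
    (hat : a ≤ t) :
    ∫⁻ s in Set.Ioc a t, ENNReal.ofReal (A * s ^ (-β)) =
      ENNReal.ofReal (A * ((t ^ (1 - β) - a ^ (1 - β)) / (1 - β))) := by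
  rw [← integral_mul_rpow_neg hβ A hat, ofReal_integral_eq_lintegral_ofReal
    (integrableOn_mul_rpow_neg hβ A a t hat)]
  filter_upwards [self_mem_ae_restrict measurableSet_Ioc] with s hs
  have : 0 < s := ha.trans_lt hs.1
  simp only [Pi.zero_apply]
  positivity

/-- Removes the endpoint `s = t`, where the semigroup time `t - s` is 0 and the kernel estimates do
not apply. -/
theorem ae_Ioc_lt (a t : ℝ) : ∀ᵐ s ∂(volume.restrict (Set.Ioc a t)), a < s ∧ s < t := by
  have h : ∀ᵐ s ∂(volume.restrict (Set.Ioc a t)), s ≠ t :=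
    ae_restrict_of_ae (by simp [ae_iff])
  filter_upwards [h, self_mem_ae_restrict measurableSet_Ioc] with s h1 h2
  exact ⟨h2.1, lt_of_le_of_ne h2.2 h1⟩

end PowerIntegral

/-! ### The weighted norm and the Duhamel integral -/

section Duhamel

variable {n : ℕ} {q : ℝ≥0∞}

/-- `max (‖g‖_q, s^α ‖g‖_∞) ≤ A`, with `α = n / (2 q)` and the supremum taken over all points. -/
def WeightedLE (q : ℝ≥0∞) (A s : ℝ) (g : EuclideanSpace ℝ (Fin n) → ℝ) : Prop :=
  eLpNorm g q volume ≤ ENNReal.ofReal A ∧ ∀ x, |g x| ≤ A * s ^ (-((n : ℝ) / (2 * q.toReal)))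

theorem WeightedLE.add (hq1 : 1 ≤ q) {A B s : ℝ} (hA : 0 ≤ A) (hB : 0 ≤ B)
    {g h : EuclideanSpace ℝ (Fin n) → ℝ} (hg : WeightedLE q A s g) (hh : WeightedLE q B s h)
    (hgm : Measurable g) (hhm : Measurable h) :
    WeightedLE q (A + B) s (fun x => g x + h x) := by
  refine ⟨?_, fun x => ?_⟩
  · rw [ENNReal.ofReal_add hA hB]
    exact (eLpNorm_add_le hgm.aestronglyMeasurable hhm.aestronglyMeasurable hq1).trans
      (add_le_add hg.1 hh.1)
  · rw [add_mul]
    exact (abs_add_le _ _).trans (add_le_add (hg.2 x) (hh.2 x))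

theorem WeightedLE.mono {A B s : ℝ} (hs : 0 < s) (hAB : A ≤ B)
    {g : EuclideanSpace ℝ (Fin n) → ℝ} (hg : WeightedLE q A s g) : WeightedLE q B s g :=
  ⟨hg.1.trans (ENNReal.ofReal_le_ofReal hAB), fun x => (hg.2 x).trans (by gcongr)⟩

theorem WeightedLE.of_abs_le {A c s : ℝ} (hc : 0 ≤ c)
    {g h : EuclideanSpace ℝ (Fin n) → ℝ} (hg : WeightedLE q A s g)
    (h_le : ∀ x, |h x| ≤ c * |g x|) : WeightedLE q (c * A) s h := by
  refine ⟨?_, fun x => ?_⟩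
  · refine (eLpNorm_le_mul_eLpNorm_of_ae_le_mul (f := h) (g := g) (c := c) (Filter.Eventually.of_forall h_le) q).trans ?_
    rw [ENNReal.ofReal_mul hc]
    exact mul_le_mul' le_rfl hg.1
  · rw [mul_assoc]
    exact (h_le x).trans (mul_le_mul_of_nonneg_left (hg.2 x) hc)

/-- Fatou's lemma for the `L^q` part, closedness of the bound at each point for the other. -/
theorem WeightedLE.of_tendsto {A s : ℝ} {g : ℕ → EuclideanSpace ℝ (Fin n) → ℝ}
    {h : EuclideanSpace ℝ (Fin n) → ℝ} (hgm : ∀ k, Measurable (g k))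
    (hg : ∀ᶠ k in Filter.atTop, WeightedLE q A s (g k))
    (hlim : ∀ x, Filter.Tendsto (fun k => g k x) Filter.atTop (nhds (h x))) :
    WeightedLE q A s h := by
  refine ⟨?_, fun x => ?_⟩
  · refine (Lp.eLpNorm_lim_le_liminf_eLpNorm (fun k => (hgm k).aestronglyMeasurable) h
      (Filter.Eventually.of_forall hlim)).trans ?_
    refine Filter.liminf_le_of_frequently_le' (Filter.Eventually.frequently ?_)
    filter_upwards [hg] with k hk using hk.1
  · exact le_of_tendsto (hlim x).abs (hg.mono fun k hk => hk.2 x)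

/-- `∫_a^t e^{(t-s)Δ} g(s) ds`. -/
def duhamelIntegral (g : ℝ → EuclideanSpace ℝ (Fin n) → ℝ) (a t : ℝ)
    (x : EuclideanSpace ℝ (Fin n)) : ℝ :=
  ∫ s in Set.Ioc a t, heatSemigroup (t - s) (g s) x

theorem measurable_duhamelIntegral {g : ℝ → EuclideanSpace ℝ (Fin n) → ℝ}
    (hg : Measurable (Function.uncurry g)) (a : ℝ) :
    Measurable (Function.uncurry (duhamelIntegral g a)) := by
  have h1 : Measurable fun w : (ℝ × ℝ) × EuclideanSpace ℝ (Fin n) =>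
      heatSemigroup (w.1.1 - w.1.2) (g w.1.2) w.2 :=
    measurable_heatSemigroup_uncurry (S := ℝ × ℝ) (τ := fun w => w.1 - w.2)
      (measurable_fst.sub measurable_snd) (g := fun w => g w.2)
      (hg.comp ((measurable_snd.comp measurable_fst).prodMk measurable_snd))
  have h2 : Measurable fun w : (ℝ × EuclideanSpace ℝ (Fin n)) × ℝ =>
      heatSemigroup (w.1.1 - w.2) (g w.2) w.1.2 :=
    h1.comp (g := fun w : (ℝ × ℝ) × EuclideanSpace ℝ (Fin n) =>
      heatSemigroup (w.1.1 - w.1.2) (g w.1.2) w.2)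
      (f := fun w : (ℝ × EuclideanSpace ℝ (Fin n)) × ℝ => ((w.1.1, w.2), w.1.2)) (by fun_prop)
  have hS : MeasurableSet {w : (ℝ × EuclideanSpace ℝ (Fin n)) × ℝ | a < w.2 ∧ w.2 ≤ w.1.1} :=
    (measurableSet_lt measurable_const measurable_snd).inter
      (measurableSet_le measurable_snd (measurable_fst.comp measurable_fst))
  have h3 := (h2.indicator hS).stronglyMeasurable.integral_prod_right' (ν := volume)
  convert h3.measurable using 1
  ext w
  simp only [Function.uncurry, duhamelIntegral]
  rw [← integral_indicator measurableSet_Ioc]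
  rfl

theorem eLpNorm_duhamelIntegral_le (hq1 : 1 ≤ q) (hq : q ≠ ∞)
    {g : ℝ → EuclideanSpace ℝ (Fin n) → ℝ} (hg : Measurable (Function.uncurry g)) (a t : ℝ) :
    eLpNorm (duhamelIntegral g a t) q volume ≤
      ∫⁻ s in Set.Ioc a t, eLpNorm (g s) q volume := by
  refine (eLpNorm_integral_le_lintegral hq1 hq
    (g := fun s x => heatSemigroup (t - s) (g s) x) ?_).trans ?_
  · exact measurable_heatSemigroup_uncurry (measurable_const.sub measurable_id) hg
  · refine lintegral_mono_ae ?_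
    filter_upwards [ae_Ioc_lt a t] with s hs
    exact eLpNorm_heatSemigroup_le hq1 hq (sub_pos.2 hs.2) (hg.comp measurable_prodMk_left)

section Bounds

variable {g : ℝ → EuclideanSpace ℝ (Fin n) → ℝ} {A β T : ℝ}

theorem ae_abs_heatSemigroup_le (hq1 : 1 ≤ q) (hq : q ≠ ∞)
    (hg : Measurable (Function.uncurry g)) (hA : 0 ≤ A)
    (hgA : ∀ s ∈ Set.Ioc 0 T, WeightedLE q (A * s ^ (-β)) s (g s)) {t : ℝ}
    (ht : t ∈ Set.Ioc 0 T) (x : EuclideanSpace ℝ (Fin n)) :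
    ∀ᵐ s ∂(volume.restrict (Set.Ioc 0 t)), ‖heatSemigroup (t - s) (g s) x‖ ≤
      (A * (2 ^ ((n : ℝ) / (2 * q.toReal)) * t ^ (-((n : ℝ) / (2 * q.toReal))))) * s ^ (-β) := by
  filter_upwards [ae_Ioc_lt 0 t] with s hs
  have hs0 := hs.1
  have h := hgA s ⟨hs.1, hs.2.le.trans ht.2⟩
  have := abs_heatSemigroup_sub_le hq1 hq hs.1 hs.2 (by positivity)
    (hg.comp measurable_prodMk_left : Measurable (g s)) h.1 (Filter.Eventually.of_forall h.2) x
  exact this.trans (le_of_eq (by ring))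

theorem integrableOn_heatSemigroup (hq1 : 1 ≤ q) (hq : q ≠ ∞) (hβ : β < 1)
    (hg : Measurable (Function.uncurry g)) (hA : 0 ≤ A)
    (hgA : ∀ s ∈ Set.Ioc 0 T, WeightedLE q (A * s ^ (-β)) s (g s)) {t : ℝ}
    (ht : t ∈ Set.Ioc 0 T) (x : EuclideanSpace ℝ (Fin n)) :
    IntegrableOn (fun s => heatSemigroup (t - s) (g s) x) (Set.Ioc 0 t) := by
  refine Integrable.mono' (integrableOn_mul_rpow_neg hβ _ 0 t ht.1.le) ?_
    (ae_abs_heatSemigroup_le hq1 hq hg hA hgA ht x)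
  exact ((measurable_heatSemigroup_uncurry (measurable_const.sub measurable_id) hg).comp
    measurable_prodMk_right).aestronglyMeasurable

theorem eLpNorm_duhamelIntegral_le_rpow (hq1 : 1 ≤ q) (hq : q ≠ ∞) (hβ : β < 1)
    (hg : Measurable (Function.uncurry g)) (hA : 0 ≤ A)
    (hgA : ∀ s ∈ Set.Ioc 0 T, WeightedLE q (A * s ^ (-β)) s (g s)) {a t : ℝ} (ha : 0 ≤ a)
    (hat : a ≤ t) (htT : t ≤ T) :
    eLpNorm (duhamelIntegral g a t) q volume ≤
      ENNReal.ofReal (A * ((t ^ (1 - β) - a ^ (1 - β)) / (1 - β))) := by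
  rw [← lintegral_mul_rpow_neg hβ hA ha hat]
  refine (eLpNorm_duhamelIntegral_le hq1 hq hg a t).trans (lintegral_mono_ae ?_)
  filter_upwards [self_mem_ae_restrict measurableSet_Ioc] with s hs
  exact (hgA s ⟨ha.trans_lt hs.1, hs.2.trans htT⟩).1

/-- Integrating `s^{-β}` over `(0, t]` gives the gain `t^{1-β}/(1-β)`. Only the sup bound needs the
factor `2^α`; the `L^q` bound is weakened so that one radius serves both. -/
theorem weightedLE_duhamelIntegral (hq1 : 1 ≤ q) (hq : q ≠ ∞) (hβ : β < 1)
    (hg : Measurable (Function.uncurry g)) (hA : 0 ≤ A)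
    (hgA : ∀ s ∈ Set.Ioc 0 T, WeightedLE q (A * s ^ (-β)) s (g s)) {t : ℝ}
    (ht : t ∈ Set.Ioc 0 T) :
    WeightedLE q (A * 2 ^ ((n : ℝ) / (2 * q.toReal)) * (t ^ (1 - β) / (1 - β))) t
      (duhamelIntegral g 0 t) := by
  have hr0 := toReal_pos_of_one_le hq1 hq
  have ht0 := ht.1
  have hγ : 0 < 1 - β := by linarith
  refine ⟨?_, fun x => ?_⟩
  · refine (eLpNorm_duhamelIntegral_le_rpow hq1 hq hβ hg hA hgA le_rfl ht.1.le ht.2).trans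
      (ENNReal.ofReal_le_ofReal ?_)
    rw [Real.zero_rpow hγ.ne', sub_zero]
    refine mul_le_mul_of_nonneg_right ?_ (by positivity)
    exact le_mul_of_one_le_right hA (Real.one_le_rpow one_le_two (by positivity))
  · have := norm_integral_le_of_norm_le (integrableOn_mul_rpow_neg hβ _ 0 t ht.1.le)
      (ae_abs_heatSemigroup_le hq1 hq hg hA hgA ht x)
    rw [integral_mul_rpow_neg hβ _ ht.1.le, Real.zero_rpow hγ.ne', sub_zero] at this
    refine this.trans (le_of_eq ?_)
    ring

end Bounds

end Duhamel

/-! ### Picard iteration in the weighted norm -/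

section Picard

open Filter Topology

variable {n : ℕ} {q : ℝ≥0∞} {p : ℝ} {f : ℝ → ℝ} {K : ℝ}

/-- On values bounded by `M s^{-α}` the Lipschitz constant of `f` is at most `2K (M s^{-α})^{p-1}`;
this is the source of the exponent `β = α(p-1)`. -/
theorem weightedLE_nonlinearity_sub (hp : 1 < p) (hK : 0 < K)
    (hf : ∀ a b : ℝ, |f a - f b| ≤ K * (|a| ^ (p - 1) + |b| ^ (p - 1)) * |a - b|)
    {M D s : ℝ} (hM : 0 ≤ M) (hs : 0 < s) {u v : EuclideanSpace ℝ (Fin n) → ℝ}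
    (hu : WeightedLE q M s u) (hv : WeightedLE q M s v)
    (huv : WeightedLE q D s (fun x => u x - v x)) :
    WeightedLE q (2 * K * M ^ (p - 1) * D * s ^ (-((n : ℝ) / (2 * q.toReal) * (p - 1)))) s
      (fun x => f (u x) - f (v x)) := by
  have := huv.of_abs_le (h := fun x => f (u x) - f (v x))
    (c := 2 * K * (M * s ^ (-((n : ℝ) / (2 * q.toReal)))) ^ (p - 1)) (by positivity)
    fun x => abs_sub_le_of_growth hp hK hf (hu.2 x) (hv.2 x)
  rw [mul_rpow_neg_rpow hM hs] at this
  convert this using 1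
  ring

theorem weightedLE_zero {M s : ℝ} (hM : 0 ≤ M) (hs : 0 < s) :
    WeightedLE q M s (fun _ : EuclideanSpace ℝ (Fin n) => 0) := by
  refine ⟨by simp, fun x => ?_⟩
  rw [abs_zero]; positivity

theorem weightedLE_nonlinearity (hp : 1 < p) (hK : 0 < K) (hf0 : f 0 = 0)
    (hf : ∀ a b : ℝ, |f a - f b| ≤ K * (|a| ^ (p - 1) + |b| ^ (p - 1)) * |a - b|)
    {M s : ℝ} (hM : 0 ≤ M) (hs : 0 < s) {u : EuclideanSpace ℝ (Fin n) → ℝ}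
    (hu : WeightedLE q M s u) :
    WeightedLE q (2 * K * M ^ (p - 1) * M * s ^ (-((n : ℝ) / (2 * q.toReal) * (p - 1)))) s
      (fun x => f (u x)) := by
  have := weightedLE_nonlinearity_sub hp hK hf hM hs hu (weightedLE_zero hM hs)
    (by simpa using hu)
  simpa [hf0] using this

/-- The right-hand side of Duhamel's formula from time zero. -/
def picardMap (f : ℝ → ℝ) (φ : EuclideanSpace ℝ (Fin n) → ℝ)
    (u : ℝ → EuclideanSpace ℝ (Fin n) → ℝ) (t : ℝ) (x : EuclideanSpace ℝ (Fin n)) : ℝ :=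
  heatSemigroup t φ x - duhamelIntegral (fun s z => f (u s z)) 0 t x

theorem measurable_picardMap (hf : Continuous f) {φ : EuclideanSpace ℝ (Fin n) → ℝ}
    (hφ : Measurable φ) {u : ℝ → EuclideanSpace ℝ (Fin n) → ℝ}
    (hu : Measurable (Function.uncurry u)) :
    Measurable (Function.uncurry (picardMap f φ u)) := by
  have h1 : Measurable fun w : ℝ × EuclideanSpace ℝ (Fin n) => heatSemigroup w.1 φ w.2 :=
    measurable_heatSemigroup_uncurry measurable_id (g := fun _ => φ) (hφ.comp measurable_snd)
  exact h1.sub (measurable_duhamelIntegral (g := fun s z => f (u s z))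
    (hf.measurable.comp hu) 0)

theorem picardMap_zero (hf0 : f 0 = 0) (φ : EuclideanSpace ℝ (Fin n) → ℝ) (t : ℝ)
    (x : EuclideanSpace ℝ (Fin n)) : picardMap f φ (fun _ _ => 0) t x = heatSemigroup t φ x := by
  simp [picardMap, duhamelIntegral, heatSemigroup, hf0]

theorem weightedLE_heatSemigroup (hq1 : 1 ≤ q) (hq : q ≠ ∞) {t R : ℝ} (ht : 0 < t) (hR : 0 ≤ R)
    {φ : EuclideanSpace ℝ (Fin n) → ℝ} (hφ : Measurable φ)
    (hφR : eLpNorm φ q volume ≤ ENNReal.ofReal R) :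
    WeightedLE q R t (heatSemigroup t φ) :=
  ⟨(eLpNorm_heatSemigroup_le hq1 hq ht hφ).trans hφR, abs_heatSemigroup_le hq1 hq ht hR hφ hφR⟩

/-- The heat flow of the datum cancels, which leaves the Duhamel integral of `f(u) - f(v)`. -/
theorem weightedLE_picardMap_sub (hq1 : 1 ≤ q) (hq : q ≠ ∞) (hp : 1 < p)
    (hβ : (n : ℝ) / (2 * q.toReal) * (p - 1) < 1) (hK : 0 < K) (hf0 : f 0 = 0)
    (hfc : Continuous f)
    (hf : ∀ a b : ℝ, |f a - f b| ≤ K * (|a| ^ (p - 1) + |b| ^ (p - 1)) * |a - b|)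
    {M D T : ℝ} (hM : 0 ≤ M) (hD : 0 ≤ D) {u v : ℝ → EuclideanSpace ℝ (Fin n) → ℝ}
    (hum : Measurable (Function.uncurry u)) (hvm : Measurable (Function.uncurry v))
    (hu : ∀ s ∈ Set.Ioc 0 T, WeightedLE q M s (u s))
    (hv : ∀ s ∈ Set.Ioc 0 T, WeightedLE q M s (v s))
    (huv : ∀ s ∈ Set.Ioc 0 T, WeightedLE q D s (fun x => u s x - v s x))
    (φ : EuclideanSpace ℝ (Fin n) → ℝ) {t : ℝ} (ht : t ∈ Set.Ioc 0 T) :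
    WeightedLE q (2 * K * M ^ (p - 1) * D * 2 ^ ((n : ℝ) / (2 * q.toReal)) *
      (t ^ (1 - (n : ℝ) / (2 * q.toReal) * (p - 1)) / (1 - (n : ℝ) / (2 * q.toReal) * (p - 1)))) t
      (fun x => picardMap f φ u t x - picardMap f φ v t x) := by
  have hfu : Measurable (Function.uncurry fun s z => f (u s z)) := hfc.measurable.comp hum
  have hfv : Measurable (Function.uncurry fun s z => f (v s z)) := hfc.measurable.comp hvm
  have hbu : ∀ s ∈ Set.Ioc 0 T, _ := fun s hs =>
    weightedLE_nonlinearity hp hK hf0 hf hM hs.1 (hu s hs)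
  have hbv : ∀ s ∈ Set.Ioc 0 T, _ := fun s hs =>
    weightedLE_nonlinearity hp hK hf0 hf hM hs.1 (hv s hs)
  have hbuv : ∀ s ∈ Set.Ioc 0 T, _ := fun s hs =>
    weightedLE_nonlinearity_sub hp hK hf hM hs.1 (hu s hs) (hv s hs) (huv s hs)
  have key := weightedLE_duhamelIntegral hq1 hq hβ (g := fun s z => f (u s z) - f (v s z))
    (hfu.sub hfv) (by positivity) hbuv ht
  have heq : ∀ x, duhamelIntegral (fun s z => f (u s z) - f (v s z)) 0 t x =
      duhamelIntegral (fun s z => f (u s z)) 0 t x -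
        duhamelIntegral (fun s z => f (v s z)) 0 t x := by
    intro x
    unfold duhamelIntegral
    rw [← integral_sub (integrableOn_heatSemigroup hq1 hq hβ hfu (by positivity) hbu ht x)
      (integrableOn_heatSemigroup hq1 hq hβ hfv (by positivity) hbv ht x)]
    refine integral_congr_ae ?_
    filter_upwards [ae_Ioc_lt 0 t] with s hs
    have hs' : s ∈ Set.Ioc 0 T := ⟨hs.1, hs.2.le.trans ht.2⟩
    exact heatSemigroup_sub hq1 hq (sub_pos.2 hs.2) (hfu.comp measurable_prodMk_left)
      (ne_top_of_le_ne_top ENNReal.ofReal_ne_top (hbu s hs').1)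
      (hfv.comp measurable_prodMk_left)
      (ne_top_of_le_ne_top ENNReal.ofReal_ne_top (hbv s hs').1) x
  have := key.of_abs_le (c := 1) (h := fun x => picardMap f φ u t x - picardMap f φ v t x)
    zero_le_one (fun x => by
      rw [heq, one_mul, ← abs_neg]
      apply le_of_eq
      congr 1
      simp only [picardMap]; ring)
  simpa only [one_mul] using this

/-- Picard iterates for Duhamel's formula. -/
def picardIterate (f : ℝ → ℝ) (φ : EuclideanSpace ℝ (Fin n) → ℝ) :
    ℕ → ℝ → EuclideanSpace ℝ (Fin n) → ℝ
  | 0 => fun _ _ => 0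
  | k + 1 => picardMap f φ (picardIterate f φ k)

theorem exists_pos_mul_rpow_le {c γ : ℝ} (hc : 0 ≤ c) (hγ : 0 < γ) :
    ∃ T : ℝ, 0 < T ∧ ∀ t ∈ Set.Ioc 0 T, c * t ^ γ ≤ 1 / 2 := by
  -- `c + 1` rather than `c`, since `c` may be 0.
  refine ⟨(1 / (2 * (c + 1))) ^ (1 / γ), by positivity, fun t ht => ?_⟩
  have h1 : t ^ γ ≤ ((1 / (2 * (c + 1))) ^ (1 / γ)) ^ γ :=
    Real.rpow_le_rpow ht.1.le ht.2 hγ.le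
  rw [← Real.rpow_mul (by positivity), one_div_mul_cancel hγ.ne', Real.rpow_one] at h1
  calc c * t ^ γ ≤ c * (1 / (2 * (c + 1))) := by gcongr
    _ ≤ 1 / 2 := by rw [mul_one_div, div_le_div_iff₀ (by positivity) (by positivity)]; linarith

/-- The fixed point is built from pointwise limits of the iterates rather than in a Banach space of
curves. This yields a jointly measurable function that satisfies the integral equation at every
point. -/
theorem exists_mild_solution (hq1 : 1 ≤ q) (hq : q ≠ ∞) (hp : 1 < p)
    (hβ : (n : ℝ) / (2 * q.toReal) * (p - 1) < 1) (hK : 0 < K) (hf0 : f 0 = 0)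
    (hfc : Continuous f)
    (hf : ∀ a b : ℝ, |f a - f b| ≤ K * (|a| ^ (p - 1) + |b| ^ (p - 1)) * |a - b|)
    {R : ℝ} (hR : 0 ≤ R) {φ : EuclideanSpace ℝ (Fin n) → ℝ} (hφ : Measurable φ)
    (hφR : eLpNorm φ q volume ≤ ENNReal.ofReal R) :
    ∃ T : ℝ, 0 < T ∧ ∃ u : ℝ → EuclideanSpace ℝ (Fin n) → ℝ, Measurable (Function.uncurry u) ∧
      (∀ t ∈ Set.Ioc 0 T, WeightedLE q (2 * R) t (u t)) ∧
      ∀ t ∈ Set.Ioc 0 T, ∀ x, u t x = picardMap f φ u t x := by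
  set α := (n : ℝ) / (2 * q.toReal) with hα
  have hγ : 0 < 1 - α * (p - 1) := by linarith
  set M := 2 * R with hMdef
  have hM : 0 ≤ M := by positivity
  obtain ⟨T, hT, hTle⟩ := exists_pos_mul_rpow_le
    (c := 2 * K * M ^ (p - 1) * 2 ^ α / (1 - α * (p - 1))) (by positivity) hγ
  have hcontr : ∀ {D : ℝ}, 0 ≤ D → ∀ {u v : ℝ → EuclideanSpace ℝ (Fin n) → ℝ},
      Measurable (Function.uncurry u) → Measurable (Function.uncurry v) →
      (∀ s ∈ Set.Ioc 0 T, WeightedLE q M s (u s)) →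
      (∀ s ∈ Set.Ioc 0 T, WeightedLE q M s (v s)) →
      (∀ s ∈ Set.Ioc 0 T, WeightedLE q D s (fun x => u s x - v s x)) →
      ∀ t ∈ Set.Ioc 0 T, WeightedLE q (D / 2) t
        (fun x => picardMap f φ u t x - picardMap f φ v t x) := by
    intro D hD u v hum hvm hu hv huv t ht
    refine (weightedLE_picardMap_sub hq1 hq hp hβ hK hf0 hfc hf hM hD hum hvm hu hv huv φ
      ht).mono ht.1 ?_
    have := mul_le_mul_of_nonneg_left (hTle t ht) hD
    calc _ = D * (2 * K * M ^ (p - 1) * 2 ^ α / (1 - α * (p - 1)) * t ^ (1 - α * (p - 1))) := by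
          rw [← hα]; ring
      _ ≤ D / 2 := by linarith
  have hheat : ∀ t ∈ Set.Ioc 0 T, WeightedLE q R t (heatSemigroup t φ) := fun t ht =>
    weightedLE_heatSemigroup hq1 hq ht.1 hR hφ hφR
  set U := picardIterate f φ with hU
  have hUs : ∀ k, U (k + 1) = picardMap f φ (U k) := fun k => rfl
  have hU0 : U 0 = fun _ _ => 0 := rfl
  have hUm : ∀ k, Measurable (Function.uncurry (U k)) := by
    intro k
    induction k with
    | zero => exact measurable_const
    | succ k ih => exact measurable_picardMap hfc hφ ih
  have hUtm : ∀ k t, Measurable (U k t) := fun k t => (hUm k).comp measurable_prodMk_left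
  have hzero : ∀ s ∈ Set.Ioc 0 T, WeightedLE q M s (U 0 s) := fun s hs => weightedLE_zero hM hs.1
  -- The image of the zero curve is the heat flow of the datum, of size `R`; contraction towards it
  -- adds at most `M/2`, and `M/2 + R = M`.
  have hstep : ∀ u : ℝ → EuclideanSpace ℝ (Fin n) → ℝ, Measurable (Function.uncurry u) →
      (∀ s ∈ Set.Ioc 0 T, WeightedLE q M s (u s)) →
      ∀ t ∈ Set.Ioc 0 T, WeightedLE q M t (picardMap f φ u t) := by
    intro u hum hu t ht
    have h1 := hcontr hM hum (hUm 0) hu hzero (by simpa [hU0] using hu) t ht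
    have h2 := h1.add hq1 (by positivity) hR (hheat t ht)
      (((measurable_picardMap hfc hφ hum).comp measurable_prodMk_left).sub
        ((measurable_picardMap hfc hφ (hUm 0)).comp measurable_prodMk_left))
      (measurable_heatSemigroup t hφ)
    rw [show M / 2 + R = M by rw [hMdef]; ring] at h2
    simpa [hU0, picardMap_zero hf0] using h2
  have hUM : ∀ k, ∀ t ∈ Set.Ioc 0 T, WeightedLE q M t (U k t) := by
    intro k
    induction k with
    | zero => exact hzero
    | succ k ih => exact hstep _ (hUm k) ih
  have hUd : ∀ k, ∀ t ∈ Set.Ioc 0 T,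
      WeightedLE q (M * (1 / 2) ^ k) t (fun x => U (k + 1) t x - U k t x) := by
    intro k
    induction k with
    | zero => intro t ht; simpa [hU0] using hUM 1 t ht
    | succ k ih =>
      intro t ht
      have := hcontr (by positivity) (hUm (k + 1)) (hUm k) (hUM _) (hUM _) ih t ht
      rw [show M * (1 / 2) ^ (k + 1) = M * (1 / 2) ^ k / 2 by rw [pow_succ]; ring]
      exact this
  -- The exact geometric partial sum, rather than its upper bound, makes the induction on `j` close.
  have hUdj : ∀ k j, ∀ t ∈ Set.Ioc 0 T,
      WeightedLE q (2 * M * (1 / 2) ^ k - 2 * M * (1 / 2) ^ (k + j)) t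
        (fun x => U (k + j) t x - U k t x) := by
    intro k j t ht
    induction j with
    | zero => simpa using weightedLE_zero le_rfl ht.1
    | succ j ih =>
      have hle : (1 / 2 : ℝ) ^ (k + j) ≤ (1 / 2) ^ k :=
        pow_le_pow_of_le_one (by norm_num) (by norm_num) (by omega)
      have := ih.add hq1 (by nlinarith) (by positivity) (hUd (k + j) t ht)
        ((hUtm _ t).sub (hUtm _ t)) ((hUtm _ t).sub (hUtm _ t))
      convert this using 1
      · rw [← add_assoc, pow_succ]; ring
      · ext x; rw [← add_assoc]; ring
  have hcauchy : ∀ t ∈ Set.Ioc 0 T, ∀ x, ∃ l, Tendsto (fun k => U k t x) atTop (𝓝 l) := by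
    intro t ht x
    refine cauchySeq_tendsto_of_complete (cauchySeq_of_le_geometric (1 / 2)
      (M * t ^ (-α)) (by norm_num) fun k => ?_)
    have := (hUd k t ht).2 x
    rw [dist_comm, Real.dist_eq]
    exact this.trans (le_of_eq (by ring))
  -- The `limsup` is defined and measurable for all `(t, x)`; it is the limit where one is known to
  -- exist.
  set u : ℝ → EuclideanSpace ℝ (Fin n) → ℝ := fun t x => limsup (fun k => U k t x) atTop with hu
  have hlim : ∀ t ∈ Set.Ioc 0 T, ∀ x, Tendsto (fun k => U k t x) atTop (𝓝 (u t x)) := by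
    intro t ht x
    obtain ⟨l, hl⟩ := hcauchy t ht x
    simp only [hu]
    rwa [hl.limsup_eq]
  have hum : Measurable (Function.uncurry u) :=
    Measurable.limsup (f := fun k (w : ℝ × EuclideanSpace ℝ (Fin n)) => U k w.1 w.2) hUm
  have huM : ∀ t ∈ Set.Ioc 0 T, WeightedLE q M t (u t) := fun t ht =>
    WeightedLE.of_tendsto (fun k => hUtm k t) (Eventually.of_forall fun k => hUM k t ht)
      (hlim t ht)
  have hud : ∀ k, ∀ t ∈ Set.Ioc 0 T,
      WeightedLE q (2 * M * (1 / 2) ^ k) t (fun x => u t x - U k t x) := by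
    intro k t ht
    refine WeightedLE.of_tendsto (g := fun j x => U (k + j) t x - U k t x)
      (fun j => (hUtm _ t).sub (hUtm _ t)) (Eventually.of_forall fun j =>
        (hUdj k j t ht).mono ht.1 (sub_le_self _ (by positivity))) fun x => ?_
    refine Tendsto.sub_const ?_ _
    have := (tendsto_add_atTop_iff_nat k).2 (hlim t ht x)
    simpa only [add_comm] using this
  refine ⟨T, hT, u, hum, huM, fun t ht x => ?_⟩
  have hconv : Tendsto (fun k => U (k + 1) t x) atTop (𝓝 (picardMap f φ u t x)) := by
    rw [tendsto_iff_dist_tendsto_zero]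
    have hz : Tendsto (fun k : ℕ => 2 * M * (1 / 2 : ℝ) ^ k / 2 * t ^ (-α)) atTop (𝓝 0) := by
      have := (((tendsto_pow_atTop_nhds_zero_of_lt_one (by norm_num : (0:ℝ) ≤ 1 / 2)
        (by norm_num)).const_mul (2 * M)).div_const 2).mul_const (t ^ (-α))
      simpa using this
    refine squeeze_zero (fun _ => dist_nonneg) (fun k => ?_) hz
    rw [dist_comm, Real.dist_eq]
    exact (hcontr (by positivity) hum (hUm k) huM (hUM k) (hud k) t ht).2 x
  exact tendsto_nhds_unique ((tendsto_add_atTop_iff_nat 1).2 (hlim t ht x)) hconv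

end Picard

/-! ### Changing the starting time in Duhamel's formula -/

section Restart

variable {n : ℕ} {q : ℝ≥0∞} {g : ℝ → EuclideanSpace ℝ (Fin n) → ℝ} {A β T : ℝ}

theorem heatSemigroup_duhamelIntegral (hq1 : 1 ≤ q) (hq : q ≠ ∞) (hβ : β < 1)
    (hg : Measurable (Function.uncurry g)) (hA : 0 ≤ A)
    (hgA : ∀ s ∈ Set.Ioc 0 T, WeightedLE q (A * s ^ (-β)) s (g s)) {τ t : ℝ} (hτ : 0 < τ)
    (hτt : τ < t) (htT : t ≤ T) (x : EuclideanSpace ℝ (Fin n)) :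
    heatSemigroup (t - τ) (duhamelIntegral g 0 τ) x =
      ∫ s in Set.Ioc 0 τ, heatSemigroup (t - s) (g s) x := by
  have hgs : ∀ s, Measurable (g s) := fun s => hg.comp measurable_prodMk_left
  have hfin : ∀ s, 0 < s → s < τ → eLpNorm (g s) q volume ≠ ∞ := fun s h1 h2 =>
    ne_top_of_le_ne_top ENNReal.ofReal_ne_top (hgA s ⟨h1, by linarith⟩).1
  have h := heatSemigroup_integral hq1 hq (μ := volume.restrict (Set.Ioc 0 τ)) (sub_pos.2 hτt)
    (g := fun s z => heatSemigroup (τ - s) (g s) z)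
    (measurable_heatSemigroup_uncurry (measurable_const.sub measurable_id) hg) ?_ x
  · refine h.trans (integral_congr_ae ?_)
    filter_upwards [ae_Ioc_lt 0 τ] with s hs
    rw [heatSemigroup_heatSemigroup hq1 hq (sub_pos.2 hτt) (sub_pos.2 hs.2) (hgs s)
      (hfin s hs.1 hs.2), sub_add_sub_cancel]
  · refine ne_top_of_le_ne_top (b := ∫⁻ s in Set.Ioc 0 τ, ENNReal.ofReal (A * s ^ (-β))) ?_
      (lintegral_mono_ae ?_)
    · rw [lintegral_mul_rpow_neg hβ hA le_rfl hτ.le]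
      exact ENNReal.ofReal_ne_top
    · filter_upwards [ae_Ioc_lt 0 τ] with s hs
      exact (eLpNorm_heatSemigroup_le hq1 hq (sub_pos.2 hs.2) (hgs s)).trans
        (hgA s ⟨hs.1, by linarith [hs.2]⟩).1

/-- Apply the flow over time `t - τ` to the formula at `τ`: by the semigroup law the old integral
becomes the part of the new one over `(0, τ]`. -/
theorem duhamel_restart (hq1 : 1 ≤ q) (hq : q ≠ ∞) (hβ : β < 1)
    (hg : Measurable (Function.uncurry g)) (hA : 0 ≤ A)
    (hgA : ∀ s ∈ Set.Ioc 0 T, WeightedLE q (A * s ^ (-β)) s (g s))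
    {φ : EuclideanSpace ℝ (Fin n) → ℝ} (hφ : Measurable φ) (hφq : eLpNorm φ q volume ≠ ∞)
    {τ t : ℝ} (hτ : 0 < τ) (hτt : τ < t) (htT : t ≤ T) (x : EuclideanSpace ℝ (Fin n)) :
    heatSemigroup t φ x - duhamelIntegral g 0 t x =
      heatSemigroup (t - τ) (fun z => heatSemigroup τ φ z - duhamelIntegral g 0 τ z) x
        - duhamelIntegral g τ t x := by
  have ht : t ∈ Set.Ioc 0 T := ⟨hτ.trans hτt, htT⟩
  have hD : eLpNorm (duhamelIntegral g 0 τ) q volume ≠ ∞ :=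
    ne_top_of_le_ne_top ENNReal.ofReal_ne_top (eLpNorm_duhamelIntegral_le_rpow hq1 hq hβ hg hA hgA
      le_rfl hτ.le (hτt.le.trans htT))
  have hDm : Measurable (duhamelIntegral g 0 τ) :=
    (measurable_duhamelIntegral hg 0).comp measurable_prodMk_left
  rw [heatSemigroup_sub hq1 hq (sub_pos.2 hτt) (measurable_heatSemigroup τ hφ)
    (ne_top_of_le_ne_top hφq (eLpNorm_heatSemigroup_le hq1 hq hτ hφ))
    hDm hD,
    heatSemigroup_heatSemigroup hq1 hq (sub_pos.2 hτt) hτ hφ hφq, sub_add_cancel]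
  have hint := integrableOn_heatSemigroup hq1 hq hβ hg hA hgA ht x
  have h2 : duhamelIntegral g 0 t x = (∫ s in Set.Ioc 0 τ, heatSemigroup (t - s) (g s) x)
      + duhamelIntegral g τ t x := by
    unfold duhamelIntegral
    rw [← setIntegral_union (Set.Ioc_disjoint_Ioc_of_le le_rfl) measurableSet_Ioc
      (hint.mono_set (Set.Ioc_subset_Ioc_right hτt.le))
      (hint.mono_set (Set.Ioc_subset_Ioc_left hτ.le)), Set.Ioc_union_Ioc_eq_Ioc hτ.le hτt.le]
  rw [heatSemigroup_duhamelIntegral hq1 hq hβ hg hA hgA hτ hτt htT x, h2]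
  ring

end Restart

/-! ### Continuity of the solution curve in `L^q` -/

section Continuity

open Filter Topology

variable {n : ℕ} {q : ℝ≥0∞}

theorem measurable_heatAverage (r : ℝ) {φ : EuclideanSpace ℝ (Fin n) → ℝ} (hφ : Measurable φ) :
    Measurable (heatAverage r φ) := by
  rcases le_or_gt r 0 with hr | hr
  · have : heatAverage r φ = heatAverage 0 φ := by
      unfold heatAverage; simp [Real.sqrt_eq_zero_of_nonpos hr]
    rwa [this, heatAverage_zero]
  · rw [heatAverage_of_pos hr]; exact measurable_heatSemigroup r hφ

/-- A curve in `L^q` that follows the heat flow up to the increments of a continuous function is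
continuous. -/
theorem continuousOn_of_eLpNorm_sub_heatAverage_le [Fact (1 ≤ q)] (hq : q ≠ ∞)
    {y : ℝ → Lp ℝ q (volume : Measure (EuclideanSpace ℝ (Fin n)))} {T : ℝ} {ω : ℝ → ℝ}
    (hω : Continuous ω)
    (h : ∀ τ t, 0 ≤ τ → τ ≤ t → t ≤ T →
      eLpNorm (fun x => y t x - heatAverage (t - τ) (y τ) x) q volume ≤
        ENNReal.ofReal (ω t - ω τ)) :
    ContinuousOn y (Set.Icc 0 T) := by
  have hq1 : 1 ≤ q := Fact.out
  have hym : ∀ t, Measurable (y t) := fun t => (Lp.stronglyMeasurable (y t)).measurable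
  intro t₀ ht₀
  rw [ContinuousWithinAt, tendsto_iff_edist_tendsto_0, ENNReal.tendsto_nhds_zero]
  intro ε hε
  obtain ⟨δ, hδ0, hδ⟩ : ∃ δ : ℝ, 0 < δ ∧
      ENNReal.ofReal δ + ENNReal.ofReal δ + ENNReal.ofReal δ ≤ ε := by
    obtain ⟨r, hr0, hr⟩ := ENNReal.lt_iff_exists_nnreal_btwn.1 hε
    have hr0' : 0 < (r : ℝ) := by exact_mod_cast hr0
    refine ⟨r / 3, by positivity, ?_⟩
    rw [← ENNReal.ofReal_add (by positivity) (by positivity),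
      ← ENNReal.ofReal_add (by positivity) (by positivity),
      show (r : ℝ) / 3 + r / 3 + r / 3 = r by ring, ENNReal.ofReal_coe_nnreal]
    exact hr.le
  obtain ⟨ρ, hρ0, hρ⟩ := Metric.continuous_iff.1 hω t₀ (δ / 2) (by positivity)
  simp only [Real.dist_eq] at hρ
  -- Both `t₀` and all nearby `t` lie after this `τ`, so left and right continuity are handled
  -- together by comparison with one heat flow started at `τ`.
  set τ := max 0 (t₀ - ρ / 2) with hτ
  have hτ0 : 0 ≤ τ := le_max_left _ _
  have hτt₀ : τ ≤ t₀ := max_le ht₀.1 (by linarith)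
  have hτω : |ω τ - ω t₀| < δ / 2 := hρ τ (by
    rw [abs_lt]; constructor <;> linarith [le_max_right 0 (t₀ - ρ / 2)])
  have hclose : ∀ t, τ ≤ t → t ≤ T → |t - t₀| < ρ →
      eLpNorm (fun x => y t x - heatAverage (t - τ) (y τ) x) q volume ≤ ENNReal.ofReal δ := by
    intro t h1 h2 h3
    refine (h τ t hτ0 h1 h2).trans (ENNReal.ofReal_le_ofReal ?_)
    have := abs_lt.1 (hρ t h3)
    have := abs_lt.1 hτω
    linarith
  have hheat : ∀ᶠ t in 𝓝[Set.Icc 0 T] t₀,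
      eLpNorm (fun x => heatAverage (t - τ) (y τ) x - heatAverage (t₀ - τ) (y τ) x) q volume ≤
        ENNReal.ofReal δ := by
    have h1 := tendsto_eLpNorm_heatAverage_sub hq1 hq (hym τ) (Lp.eLpNorm_ne_top (y τ)) (t₀ - τ)
    have h2 : Tendsto (fun t => t - τ) (𝓝[Set.Icc 0 T] t₀) (𝓝 (t₀ - τ)) :=
      ((continuous_sub_right τ).tendsto t₀).mono_left nhdsWithin_le_nhds
    exact ENNReal.tendsto_nhds_zero.1 (h1.comp h2) _ (ENNReal.ofReal_pos.2 hδ0)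
  have hnear : ∀ᶠ t in 𝓝[Set.Icc 0 T] t₀, |t - t₀| < ρ / 2 :=
    mem_nhdsWithin_of_mem_nhds (by
      simpa [Real.dist_eq, Metric.ball] using Metric.ball_mem_nhds t₀ (half_pos hρ0))
  filter_upwards [hheat, hnear, self_mem_nhdsWithin] with t h1 h2 ht
  have hτt : τ ≤ t := max_le ht.1 (by linarith [(abs_lt.1 h2).1])
  have hm : ∀ r, Measurable (heatAverage r (y τ)) := fun r => measurable_heatAverage r (hym τ)
  refine le_trans ?_ hδ
  rw [Lp.edist_def]
  have hsplit : (y t : EuclideanSpace ℝ (Fin n) → ℝ) - y t₀ =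
      ((fun x => y t x - heatAverage (t - τ) (y τ) x) +
        fun x => heatAverage (t - τ) (y τ) x - heatAverage (t₀ - τ) (y τ) x) -
        fun x => y t₀ x - heatAverage (t₀ - τ) (y τ) x := by
    ext x; simp
  rw [hsplit]
  refine (eLpNorm_sub_le ((((hym t).sub (hm _)).add ((hm _).sub (hm _))).aestronglyMeasurable)
    ((hym t₀).sub (hm _)).aestronglyMeasurable hq1).trans ?_
  refine add_le_add ((eLpNorm_add_le ((hym t).sub (hm _)).aestronglyMeasurable
    ((hm _).sub (hm _)).aestronglyMeasurable hq1).trans (add_le_add ?_ h1)) ?_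
  · exact hclose t hτt ht.2 (by linarith)
  · exact hclose t₀ hτt₀ ht₀.2 (by simpa using hρ0)

end Continuity

/-! ### Existence of a solution with the smoothing bound -/

section Existence

variable {n : ℕ} {q : ℝ≥0∞} {p : ℝ} {f : ℝ → ℝ}

theorem exponent_lt_one (hq1 : 1 ≤ q) (hq : q ≠ ∞)
    (hqp : (n : ℝ) * (p - 1) / 2 < q.toReal) : (n : ℝ) / (2 * q.toReal) * (p - 1) < 1 := by
  have hr0 := toReal_pos_of_one_le hq1 hq
  rw [div_mul_eq_mul_div, div_lt_one (by positivity)]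
  linarith

theorem exists_isSolution [Fact (1 ≤ q)] (hq : q ≠ ∞) (hp : 1 < p)
    (hqp : (n : ℝ) * (p - 1) / 2 < q.toReal) (hf : PowerNonlinearity p f)
    (y₀ : Lp ℝ q (volume : Measure (EuclideanSpace ℝ (Fin n)))) :
    ∃ T : ℝ, 0 < T ∧ ∃ y : ℝ → Lp ℝ q (volume : Measure (EuclideanSpace ℝ (Fin n))),
      IsSolution f y₀ T y ∧ (∀ t ∈ Set.Ioc 0 T, Duhamel f y 0 t) ∧
      ∀ t ∈ Set.Ioc 0 T, MemLp (y t) ∞ volume ∧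
        ‖y t‖ + t ^ ((n : ℝ) / (2 * q.toReal)) * (eLpNorm (y t) ∞ volume).toReal ≤ 4 * ‖y₀‖ := by
  have hq1 : 1 ≤ q := Fact.out
  have hβ := exponent_lt_one hq1 hq hqp
  obtain ⟨K, hK, hgr⟩ := hf.growth
  have hfc : Continuous f := hf.contDiff.continuous
  have hφ : Measurable y₀ := (Lp.stronglyMeasurable y₀).measurable
  have hφR : eLpNorm y₀ q volume ≤ ENNReal.ofReal ‖y₀‖ := by
    rw [Lp.norm_def, ENNReal.ofReal_toReal (Lp.eLpNorm_ne_top y₀)]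
  have hφq : eLpNorm y₀ q volume ≠ ∞ := Lp.eLpNorm_ne_top y₀
  obtain ⟨T, hT, u, hum, huM, hu⟩ := exists_mild_solution hq1 hq hp hβ hK hf.map_zero hfc hgr
    (norm_nonneg y₀) hφ hφR
  set M := 2 * ‖y₀‖ with hMdef
  have hM : 0 ≤ M := by positivity
  have hutm : ∀ t, Measurable (u t) := fun t => hum.comp measurable_prodMk_left
  have humem : ∀ t ∈ Set.Ioc 0 T, MemLp (u t) q volume := fun t ht =>
    ⟨(hutm t).aestronglyMeasurable, (huM t ht).1.trans_lt ENNReal.ofReal_lt_top⟩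
  set g : ℝ → EuclideanSpace ℝ (Fin n) → ℝ := fun s z => f (u s z) with hg
  have hgm : Measurable (Function.uncurry g) := hfc.measurable.comp hum
  set α := (n : ℝ) / (2 * q.toReal) with hα
  set A := 2 * K * M ^ (p - 1) * M with hA
  have hA0 : 0 ≤ A := by positivity
  have hgA : ∀ s ∈ Set.Ioc 0 T, WeightedLE q (A * s ^ (-(α * (p - 1)))) s (g s) := fun s hs =>
    weightedLE_nonlinearity hp hK hf.map_zero hgr hM hs.1 (huM s hs)
  classical
  -- The default value `y₀` supplies the initial condition at `t = 0`.
  set y : ℝ → Lp ℝ q (volume : Measure (EuclideanSpace ℝ (Fin n))) := fun t =>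
    if h : t ∈ Set.Ioc 0 T then (humem t h).toLp (u t) else y₀ with hy
  have hyu : ∀ t ∈ Set.Ioc 0 T, y t =ᵐ[volume] u t := fun t ht => by
    simp only [hy, dif_pos ht]; exact MemLp.coeFn_toLp _
  have hy0 : y 0 = y₀ := by simp [hy]
  have hfy : ∀ s ∈ Set.Ioc 0 T, ∀ r, heatSemigroup r (fun z => f (y s z)) = heatSemigroup r (g s) :=
    fun s hs r => heatSemigroup_congr_ae (by
      filter_upwards [hyu s hs] with z hz; simp only [hg, hz]) r
  have hduh : ∀ τ t, 0 ≤ τ → τ < t → t ≤ T → ∀ᵐ x, y t x =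
      heatSemigroup (t - τ) (y τ) x - duhamelIntegral g τ t x := by
    intro τ t hτ hτt htT
    have ht : t ∈ Set.Ioc 0 T := ⟨hτ.trans_lt hτt, htT⟩
    filter_upwards [hyu t ht] with x hx
    rw [hx, hu t ht x]
    rcases hτ.eq_or_lt with rfl | hτ
    · rw [hy0, sub_zero]; rfl
    · have hτ' : τ ∈ Set.Ioc 0 T := ⟨hτ, hτt.le.trans htT⟩
      rw [heatSemigroup_congr_ae (hyu τ hτ'),
        show u τ = fun z => picardMap f y₀ u τ z from funext (hu τ hτ')]
      exact duhamel_restart hq1 hq hβ hgm hA0 hgA hφ hφq hτ hτt htT x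
  have hDuhamel : ∀ τ t, 0 ≤ τ → τ < t → t ≤ T → Duhamel f y τ t := by
    intro τ t hτ hτt htT
    have ht : t ∈ Set.Ioc 0 T := ⟨hτ.trans_lt hτt, htT⟩
    filter_upwards [hduh τ t hτ hτt htT] with x hx
    have heq : Set.EqOn (fun s => heatSemigroup (t - s) (g s) x)
        (fun s => heatSemigroup (t - s) (fun z => f (y s z)) x) (Set.Ioc τ t) := fun s hs => by
      simp only [hfy s ⟨hτ.trans_lt hs.1, hs.2.trans htT⟩ (t - s)]
    refine ⟨?_, ?_⟩
    · rw [intervalIntegrable_iff_integrableOn_Ioc_of_le hτt.le]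
      exact ((integrableOn_heatSemigroup hq1 hq hβ hgm hA0 hgA ht x).mono_set
        (Set.Ioc_subset_Ioc_left hτ)).congr_fun heq measurableSet_Ioc
    · rw [hx, intervalIntegral.integral_of_le hτt.le, duhamelIntegral,
        setIntegral_congr_fun measurableSet_Ioc heq]
  have hsup : ∀ t ∈ Set.Ioc 0 T, eLpNorm (y t) ∞ volume ≤ ENNReal.ofReal (M * t ^ (-α)) := by
    intro t ht
    rw [eLpNorm_congr_ae (hyu t ht), eLpNorm_exponent_top]
    refine eLpNormEssSup_le_of_ae_enorm_bound (Filter.Eventually.of_forall fun x => ?_)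
    rw [Real.enorm_eq_ofReal_abs]
    exact ENNReal.ofReal_le_ofReal ((huM t ht).2 x)
  have hα0 : 0 ≤ α := by positivity
  refine ⟨T, hT, y, ⟨?_, ?_, hy0, fun τ t h1 h2 h3 => hDuhamel τ t h1.le h2 h3.le⟩,
    fun t ht => hDuhamel 0 t le_rfl ht.1 ht.2, fun t ht => ⟨?_, ?_⟩⟩
  · have hγ : 0 < 1 - α * (p - 1) := by linarith
    refine continuousOn_of_eLpNorm_sub_heatAverage_le hq
      -- A primitive of `A s^{-β}`, continuous at 0 because `β < 1`.
      (ω := fun t => A * (t ^ (1 - α * (p - 1)) / (1 - α * (p - 1))))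
      (continuous_const.mul ((Real.continuous_rpow_const hγ.le).div_const _)) ?_
    intro τ t hτ hτt htT
    rcases hτt.eq_or_lt with rfl | hτt'
    · simp [heatAverage_zero]
    · rw [heatAverage_of_pos (sub_pos.2 hτt')]
      have h1 : (fun x => y t x - heatSemigroup (t - τ) (y τ) x) =ᵐ[volume]
          -duhamelIntegral g τ t := by
        filter_upwards [hduh τ t hτ hτt' htT] with x hx
        rw [hx, Pi.neg_apply]; ring
      rw [eLpNorm_congr_ae h1, eLpNorm_neg]
      refine (eLpNorm_duhamelIntegral_le_rpow hq1 hq hβ hgm hA0 hgA hτ hτt htT).trans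
        (le_of_eq ?_)
      congr 1; ring
  · intro a b ha hab hbT
    refine ⟨(M * a ^ (-α)).toNNReal, ?_⟩
    filter_upwards [self_mem_ae_restrict measurableSet_Icc] with s hs
    refine (hsup s ⟨ha.trans_le hs.1, hs.2.trans hbT.le⟩).trans ?_
    refine ENNReal.ofReal_le_ofReal (mul_le_mul_of_nonneg_left ?_ hM)
    exact Real.rpow_le_rpow_of_nonpos ha hs.1 (by linarith)
  · exact ⟨(Lp.aestronglyMeasurable _), (hsup t ht).trans_lt ENNReal.ofReal_lt_top⟩
  · have ht0 := ht.1
    have h1 : ‖y t‖ ≤ M := by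
      rw [Lp.norm_def, eLpNorm_congr_ae (hyu t ht)]
      exact ENNReal.toReal_le_of_le_ofReal hM (huM t ht).1
    have h2 : (eLpNorm (y t) ∞ volume).toReal ≤ M * t ^ (-α) :=
      ENNReal.toReal_le_of_le_ofReal (by positivity) (hsup t ht)
    have h3 : t ^ α * (M * t ^ (-α)) = M := by
      rw [Real.rpow_neg ht0.le]; field_simp
    have h4 : t ^ α * (eLpNorm (y t) ∞ volume).toReal ≤ M := by
      rw [← h3]; gcongr
    linarith

end Existence

/-! ### Pointwise bounds and measurability for curves in `L^q` -/

section LpCurves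

open Filter Topology

variable {n : ℕ} {q : ℝ≥0∞}

/-- A sequence convergent in `L^q` has an almost everywhere convergent subsequence. -/
theorem isClosed_setOf_ae_abs_le [Fact (1 ≤ q)] {X : Type*} [MeasurableSpace X] (μ : Measure X)
    (M : ℝ) : IsClosed {v : Lp ℝ q μ | ∀ᵐ x ∂μ, |v x| ≤ M} := by
  refine IsSeqClosed.isClosed fun v w hv hvw => ?_
  obtain ⟨ns, -, hns⟩ := (tendstoInMeasure_of_tendsto_Lp hvw).exists_seq_tendsto_ae
  have hall : ∀ᵐ x ∂μ, ∀ k, |v k x| ≤ M := ae_all_iff.2 hv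
  filter_upwards [hns, hall] with x hx hM
  exact le_of_tendsto hx.abs (Eventually.of_forall fun k => hM (ns k))

/-- A locally bounded continuous curve is bounded at every time of a compact interval. -/
theorem exists_ae_abs_le [Fact (1 ≤ q)]
    {z : ℝ → Lp ℝ q (volume : Measure (EuclideanSpace ℝ (Fin n)))} {T : ℝ}
    (hz : ContinuousOn z (Set.Icc 0 T)) (hb : LocallyBounded z T) {a b : ℝ} (ha : 0 < a)
    (hab : a ≤ b) (hbT : b < T) :
    ∃ M : ℝ, 0 ≤ M ∧ ∀ s ∈ Set.Icc a b, ∀ᵐ x, |z s x| ≤ M := by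
  obtain ⟨M, hM⟩ := hb (a / 2) ((b + T) / 2) (by linarith) (by linarith) (by linarith)
  refine ⟨M, M.2, fun s hs => ?_⟩
  rw [ae_restrict_iff' measurableSet_Icc] at hM
  -- A bound at almost every time holds on a dense set of times; continuity in `L^q` and closedness
  -- of the bound carry it to every time.
  have hd := Measure.dense_of_ae hM
  set O := Set.Ioo (a / 2) ((b + T) / 2) with hO
  have hsO : s ∈ O := ⟨by linarith [hs.1], by linarith [hs.2]⟩
  have hcl : s ∈ closure (O ∩ {x | x ∈ Set.Icc (a / 2) ((b + T) / 2) →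
      eLpNorm (z x) ∞ volume ≤ M}) :=
    hd.open_subset_closure_inter isOpen_Ioo hsO
  have hcont : ContinuousAt z s :=
    (hz s ⟨by linarith [hs.1], by linarith [hs.2]⟩).continuousAt
      (Icc_mem_nhds (by linarith [hs.1]) (by linarith [hs.2]))
  have := hcont.continuousWithinAt.mem_closure (s := O ∩ {x | x ∈ Set.Icc (a / 2) ((b + T) / 2) →
      eLpNorm (z x) ∞ volume ≤ M}) (t := {v | ∀ᵐ x, |v x| ≤ (M : ℝ)}) hcl (by
    intro r hr
    have h1 := hr.2 ⟨hr.1.1.le, hr.1.2.le⟩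
    rw [eLpNorm_exponent_top] at h1
    filter_upwards [enorm_ae_le_eLpNormEssSup (z r) volume] with x hx
    have h2 := hx.trans h1
    rw [Real.enorm_eq_ofReal_abs, ← ENNReal.ofReal_coe_nnreal] at h2
    exact (ENNReal.ofReal_le_ofReal_iff M.2).1 h2)
  rwa [(isClosed_setOf_ae_abs_le volume (M : ℝ)).closure_eq] at this

/-- A continuous curve in `L^q` has a jointly measurable representative. -/
theorem exists_measurable_representative [Fact (1 ≤ q)]
    {z : ℝ → Lp ℝ q (volume : Measure (EuclideanSpace ℝ (Fin n)))} {T : ℝ}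
    (hz : ContinuousOn z (Set.Icc 0 T)) :
    ∃ Z : ℝ → EuclideanSpace ℝ (Fin n) → ℝ, Measurable (Function.uncurry Z) ∧
      ∀ s ∈ Set.Icc 0 T, Z s =ᵐ[volume] z s := by
  have hq1 : 1 ≤ q := Fact.out
  have hu : UniformContinuousOn z (Set.Icc 0 T) :=
    isCompact_Icc.uniformContinuousOn_of_continuous hz
  rw [Metric.uniformContinuousOn_iff] at hu
  choose h h0 hh using fun j : ℕ => hu ((1 / 2) ^ j / 2) (by positivity)
  -- Sampling on a grid involves only countably many classes, so joint measurability is free. The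
  -- mesh `h j` makes the errors summable, hence the whole sequence converges almost everywhere for
  -- each `s` in `[0, T]`.
  set Z : ℕ → ℝ → EuclideanSpace ℝ (Fin n) → ℝ := fun j s => z (h j * ⌊s / h j⌋) with hZ
  have hZm : ∀ j, Measurable (Function.uncurry (Z j)) := by
    intro j
    have h1 : Measurable fun w : ℤ × EuclideanSpace ℝ (Fin n) => z (h j * w.1) w.2 :=
      measurable_from_prod_countable_right fun k =>
        (Lp.stronglyMeasurable (z (h j * (k : ℝ)))).measurable
    exact h1.comp (((Int.measurable_floor.comp (measurable_id.div_const (h j))).comp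
      measurable_fst).prodMk measurable_snd)
  refine ⟨fun s x => limsup (fun j => Z j s x) atTop,
    Measurable.limsup (f := fun j (w : ℝ × EuclideanSpace ℝ (Fin n)) => Z j w.1 w.2) hZm,
    fun s hs => ?_⟩
  have hdist : ∀ j, dist (z (h j * ⌊s / h j⌋)) (z s) < (1 / 2) ^ j / 2 := by
    intro j
    have h1 : h j * ⌊s / h j⌋ ≤ s := by
      have := Int.floor_le (s / h j)
      rw [le_div_iff₀ (h0 j)] at this
      linarith
    have h2 : s < h j * ⌊s / h j⌋ + h j := by
      have := Int.lt_floor_add_one (s / h j)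
      rw [div_lt_iff₀ (h0 j)] at this
      linarith
    have h3 : 0 ≤ h j * (⌊s / h j⌋ : ℝ) := by
      have : 0 ≤ ⌊s / h j⌋ := Int.floor_nonneg.2 (div_nonneg hs.1 (h0 j).le)
      have : (0 : ℝ) ≤ ⌊s / h j⌋ := by exact_mod_cast this
      have := h0 j
      positivity
    refine hh j _ ⟨h3, h1.trans hs.2⟩ s hs ?_
    rw [Real.dist_eq, abs_lt]
    constructor <;> linarith [h0 j]
  have hlim : Tendsto (fun j => z (h j * ⌊s / h j⌋)) atTop (𝓝 (z s)) := by
    rw [tendsto_iff_dist_tendsto_zero]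
    refine squeeze_zero (fun _ => dist_nonneg) (fun j => (hdist j).le) ?_
    simpa using (tendsto_pow_atTop_nhds_zero_of_lt_one (by norm_num : (0:ℝ) ≤ 1 / 2)
      (by norm_num)).div_const 2
  have hae : ∀ᵐ x, ∃ l : ℝ, Tendsto (fun j => Z j s x) atTop (𝓝 l) := by
    refine Lp.ae_tendsto_of_cauchy_eLpNorm (p := q) (B := fun N => ENNReal.ofReal ((1 / 2) ^ N))
      (fun j => (Lp.stronglyMeasurable _).aestronglyMeasurable) hq1 ?_ ?_
    · rw [← ENNReal.ofReal_tsum_of_nonneg (fun _ => by positivity) summable_geometric_two]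
      exact ENNReal.ofReal_ne_top
    · intro N i j hi hj
      have h1 : eLpNorm (Z i s - Z j s) q volume =
          edist (z (h i * ⌊s / h i⌋)) (z (h j * ⌊s / h j⌋)) := (Lp.edist_def _ _).symm
      rw [h1, edist_dist, ENNReal.ofReal_lt_ofReal_iff (by positivity)]
      have hi' : (1 / 2 : ℝ) ^ i ≤ (1 / 2) ^ N :=
        pow_le_pow_of_le_one (by norm_num) (by norm_num) hi
      have hj' : (1 / 2 : ℝ) ^ j ≤ (1 / 2) ^ N :=
        pow_le_pow_of_le_one (by norm_num) (by norm_num) hj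
      have := dist_triangle_right (z (h i * ⌊s / h i⌋)) (z (h j * ⌊s / h j⌋)) (z s)
      linarith [hdist i, hdist j]
  obtain ⟨ns, hns, hconv⟩ := (tendstoInMeasure_of_tendsto_Lp hlim).exists_seq_tendsto_ae
  filter_upwards [hae, hconv] with x hx hx2
  obtain ⟨l, hl⟩ := hx
  simp only [hl.limsup_eq]
  exact tendsto_nhds_unique (hl.comp hns.tendsto_atTop) hx2

end LpCurves

/-! ### A priori smoothing bound for arbitrary solutions -/

section APriori

variable {n : ℕ} {q : ℝ≥0∞} {p : ℝ} {f : ℝ → ℝ} {K : ℝ}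

theorem intervalIntegrable_mul_rpow_sub {β : ℝ} (hβ : β < 1) (A τ t : ℝ) :
    IntervalIntegrable (fun r => A * (r - τ) ^ (-β)) volume τ t := by
  have := (intervalIntegral.intervalIntegrable_rpow' (a := 0) (b := t - τ)
    (by linarith : -1 < -β)).comp_sub_right τ
  simpa using this.const_mul A

theorem integral_mul_rpow_sub {β : ℝ} (hβ : β < 1) (A τ t : ℝ) :
    ∫ r in τ..t, A * (r - τ) ^ (-β) = A * ((t - τ) ^ (1 - β) / (1 - β)) := by
  rw [intervalIntegral.integral_comp_sub_right (fun r => A * r ^ (-β)), sub_self,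
    intervalIntegral.integral_const_mul, integral_rpow (Or.inl (by linarith)),
    show -β + 1 = 1 - β by ring, Real.zero_rpow (by linarith), sub_zero]

theorem eLpNorm_nonlinearity_sub_le (hp : 1 < p) (hK : 0 < K)
    (hf : ∀ a b : ℝ, |f a - f b| ≤ K * (|a| ^ (p - 1) + |b| ^ (p - 1)) * |a - b|)
    {B : ℝ} {u v : EuclideanSpace ℝ (Fin n) → ℝ} (hu : ∀ᵐ x, |u x| ≤ B) (hv : ∀ᵐ x, |v x| ≤ B) :
    eLpNorm (fun x => f (u x) - f (v x)) q volume ≤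
      ENNReal.ofReal (2 * K * B ^ (p - 1)) * eLpNorm (fun x => u x - v x) q volume := by
  refine eLpNorm_le_mul_eLpNorm_of_ae_le_mul (c := 2 * K * B ^ (p - 1)) ?_ q
  filter_upwards [hu, hv] with x h1 h2
  exact abs_sub_le_of_growth hp hK hf h1 h2

theorem eLpNorm_nonlinearity_le (hp : 1 < p) (hK : 0 < K) (hf0 : f 0 = 0)
    (hf : ∀ a b : ℝ, |f a - f b| ≤ K * (|a| ^ (p - 1) + |b| ^ (p - 1)) * |a - b|)
    {B : ℝ} (hB : 0 ≤ B) {u : EuclideanSpace ℝ (Fin n) → ℝ} (hu : ∀ᵐ x, |u x| ≤ B) :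
    eLpNorm (fun x => f (u x)) q volume ≤
      ENNReal.ofReal (2 * K * B ^ (p - 1)) * eLpNorm u q volume := by
  have := eLpNorm_nonlinearity_sub_le (q := q) hp hK hf hu
    (v := fun _ => 0) (Filter.Eventually.of_forall fun x => by simpa using hB)
  simpa [hf0] using this

theorem abs_nonlinearity_le (hp : 1 < p) (hK : 0 < K) (hf0 : f 0 = 0)
    (hf : ∀ a b : ℝ, |f a - f b| ≤ K * (|a| ^ (p - 1) + |b| ^ (p - 1)) * |a - b|)
    {a B : ℝ} (ha : |a| ≤ B) : |f a| ≤ 2 * K * B ^ (p - 1) * B := by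
  have hB : 0 ≤ B := (abs_nonneg a).trans ha
  have := abs_sub_le_of_growth hp hK hf ha (by simpa using hB : |(0:ℝ)| ≤ B)
  rw [hf0, sub_zero, sub_zero] at this
  exact this.trans (by gcongr)

variable [Fact (1 ≤ q)] {T : ℝ} {y₀ : Lp ℝ q (volume : Measure (EuclideanSpace ℝ (Fin n)))}
  {z : ℝ → Lp ℝ q (volume : Measure (EuclideanSpace ℝ (Fin n)))}

/-- If the smoothing bound `A (t - τ)^{-α}` holds up to the time `s`, and a possibly large bound
`M` afterwards, then a sharper bound holds shortly after `s`. -/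
theorem ae_abs_le_of_ae_abs_le (hq : q ≠ ∞) (hp : 1 < p)
    (hβ : (n : ℝ) / (2 * q.toReal) * (p - 1) < 1) (hK : 0 < K) (hf0 : f 0 = 0)
    (hfc : Continuous f)
    (hf : ∀ a b : ℝ, |f a - f b| ≤ K * (|a| ^ (p - 1) + |b| ^ (p - 1)) * |a - b|)
    {R A M τ s t : ℝ} (hA : 0 ≤ A) (hRA : R ≤ A) (hM : 0 ≤ M) (hτs : τ ≤ s) (hst : s < t)
    (hzR : ∀ r ∈ Set.Icc τ t, ‖z r‖ ≤ R)
    (hzA : ∀ r ∈ Set.Ioc τ s, ∀ᵐ x, |z r x| ≤ A * (r - τ) ^ (-((n : ℝ) / (2 * q.toReal))))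
    (hzM : ∀ r ∈ Set.Icc τ t, ∀ᵐ x, |z r x| ≤ M) (hd : Duhamel f z τ t) :
    ∀ᵐ x, |z t x| ≤ (R + 2 * K * A ^ (p - 1) * A * 2 ^ ((n : ℝ) / (2 * q.toReal)) *
      ((t - τ) ^ (1 - (n : ℝ) / (2 * q.toReal) * (p - 1)) /
        (1 - (n : ℝ) / (2 * q.toReal) * (p - 1)))) * (t - τ) ^ (-((n : ℝ) / (2 * q.toReal)))
      + 2 * K * M ^ (p - 1) * M * (t - s) := by
  have hq1 : 1 ≤ q := Fact.out
  set α := (n : ℝ) / (2 * q.toReal) with hα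
  have hτt : τ < t := hτs.trans_lt hst
  have htτ : 0 < t - τ := sub_pos.2 hτt
  have hzm : ∀ r, Measurable (z r) := fun r => (Lp.stronglyMeasurable (z r)).measurable
  have hzn : ∀ r ∈ Set.Icc τ t, eLpNorm (z r) q volume ≤ ENNReal.ofReal R := fun r hr => by
    rw [← ENNReal.ofReal_toReal (Lp.eLpNorm_ne_top (z r)), ← Lp.norm_def]
    exact ENNReal.ofReal_le_ofReal (hzR r hr)
  have hR : 0 ≤ R := (norm_nonneg _).trans (hzR τ ⟨le_rfl, hτt.le⟩)
  set c := 2 * K * A ^ (p - 1) * A * (2 ^ α * (t - τ) ^ (-α)) with hc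
  have hc0 : 0 ≤ c := by positivity
  set m := 2 * K * M ^ (p - 1) * M with hm
  have hm0 : 0 ≤ m := by positivity
  -- Majorant of the Duhamel integrand: up to `s` the smoothing bound is available in the shifted
  -- time `r - τ`; after `s` only `M` is, and it contributes `m (t - s)`.
  set b : ℝ → ℝ := fun r => c * (r - τ) ^ (-(α * (p - 1))) + (Set.Ioc s t).indicator (fun _ => m) r
    with hb
  have hi1 := intervalIntegrable_mul_rpow_sub hβ c τ t
  have hind : Integrable ((Set.Ioc s t).indicator fun _ : ℝ => m) :=
    (integrable_indicator_iff measurableSet_Ioc).2 (integrableOn_const (by simp))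
  have hi2 : IntervalIntegrable ((Set.Ioc s t).indicator fun _ : ℝ => m) volume τ t :=
    hind.intervalIntegrable
  have hbi : IntervalIntegrable b volume τ t := hi1.add hi2
  have hbint : ∫ r in τ..t, b r = c * ((t - τ) ^ (1 - α * (p - 1)) / (1 - α * (p - 1)))
      + m * (t - s) := by
    simp only [hb]
    rw [intervalIntegral.integral_add hi1 hi2, integral_mul_rpow_sub hβ,
      intervalIntegral.integral_of_le hτt.le, setIntegral_indicator measurableSet_Ioc,
      Set.inter_eq_self_of_subset_right (Set.Ioc_subset_Ioc_left hτs)]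
    simp [hst.le, mul_comm]
  have hbound : ∀ x, ∀ᵐ r, r ∈ Set.Ioc τ t →
      ‖heatSemigroup (t - r) (fun w => f (z r w)) x‖ ≤ b r := by
    intro x
    have hne : ∀ᵐ r : ℝ, r ≠ t := by simp [ae_iff]
    filter_upwards [hne] with r hrt hr
    have hr' : r < t := lt_of_le_of_ne hr.2 hrt
    have hrτ : 0 < r - τ := sub_pos.2 hr.1
    rcases le_or_gt r s with hrs | hrs
    · have hbr : b r = c * (r - τ) ^ (-(α * (p - 1))) := by
        simp [hb, Set.indicator_of_notMem, hrs]
      have hzr := hzA r ⟨hr.1, hrs⟩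
      have h1 := abs_heatSemigroup_sub_le hq1 hq (s := r - τ) (t := t - τ)
        (A := 2 * K * A ^ (p - 1) * A * (r - τ) ^ (-(α * (p - 1)))) hrτ (by linarith)
        (by positivity) (hfc.measurable.comp (hzm r)) ?_ ?_ x
      · rw [sub_sub_sub_cancel_right] at h1
        rw [hbr, hc]
        refine h1.trans (le_of_eq ?_)
        rw [← hα]; ring
      · refine (eLpNorm_nonlinearity_le hp hK hf0 hf (by positivity) hzr).trans ?_
        rw [mul_rpow_neg_rpow hA hrτ]
        refine (mul_le_mul' le_rfl ((hzn r ⟨hr.1.le, hr.2⟩).trans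
          (ENNReal.ofReal_le_ofReal hRA))).trans (le_of_eq ?_)
        rw [← ENNReal.ofReal_mul (by positivity)]
        congr 1; ring
      · filter_upwards [hzr] with w hw
        refine (abs_nonlinearity_le hp hK hf0 hf hw).trans (le_of_eq ?_)
        rw [mul_rpow_neg_rpow hA hrτ]
        ring
    · have hbr : m ≤ b r := by
        simp only [hb]
        rw [Set.indicator_of_mem (show r ∈ Set.Ioc s t from ⟨hrs, hr.2⟩)]
        have : 0 ≤ c * (r - τ) ^ (-(α * (p - 1))) := by positivity
        linarith
      refine (abs_heatSemigroup_le_of_bound (sub_pos.2 hr') ?_ x).trans hbr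
      filter_upwards [hzM r ⟨hr.1.le, hr.2⟩] with w hw
      exact abs_nonlinearity_le hp hK hf0 hf hw
  filter_upwards [hd] with x hx
  rw [hx.2]
  have h1 := abs_heatSemigroup_le hq1 hq htτ hR (hzm τ) (hzn τ ⟨le_rfl, hτt.le⟩) x
  have h2 := intervalIntegral.norm_integral_le_of_norm_le hτt.le (hbound x) hbi
  rw [hbint, Real.norm_eq_abs] at h2
  refine (abs_sub _ _).trans ((add_le_add h1 h2).trans (le_of_eq ?_))
  rw [hc, ← hα]; ring

/-- The sup bound `M` on `[t/2, t]` may blow up as `t → 0`. It enters only through the step length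
`h`, while `A` and `δ` depend on the bound `R` for the `L^q` norm, so the estimate is uniform in
`t`. -/
theorem ae_abs_le_of_isSolution (hq : q ≠ ∞) (hp : 1 < p)
    (hqp : (n : ℝ) * (p - 1) / 2 < q.toReal) (hf : PowerNonlinearity p f) (hT : 0 < T)
    (hz : IsSolution f y₀ T z) :
    ∃ A δ : ℝ, 0 ≤ A ∧ 0 < δ ∧ δ < T ∧ ∀ t ∈ Set.Ioc 0 δ,
      ∀ᵐ x, |z t x| ≤ A * t ^ (-((n : ℝ) / (2 * q.toReal))) := by
  have hq1 : 1 ≤ q := Fact.out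
  have hβ := exponent_lt_one hq1 hq hqp
  obtain ⟨K, hK, hgr⟩ := hf.growth
  have hfc : Continuous f := hf.contDiff.continuous
  obtain ⟨R, hR⟩ := isCompact_Icc.exists_bound_of_continuousOn hz.continuousOn
  have hR0 : 0 ≤ R := (norm_nonneg _).trans (hR 0 ⟨le_rfl, hT.le⟩)
  set α := (n : ℝ) / (2 * q.toReal) with hα
  have hα0 : 0 ≤ α := by positivity
  have hγ : 0 < 1 - α * (p - 1) := by linarith
  -- Chosen so that `R + A/2 + 1/2 = A`: linear part, Duhamel part before the last step, and last
  -- step.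
  set A := 2 * R + 1 with hA
  have hA0 : 0 < A := by positivity
  obtain ⟨T₁, hT₁, hT₁le⟩ := exists_pos_mul_rpow_le
    (c := 2 * K * A ^ (p - 1) * 2 ^ α / (1 - α * (p - 1))) (by positivity) hγ
  set δ := min T₁ (T / 2) with hδ
  have hδ0 : 0 < δ := lt_min hT₁ (by positivity)
  have hδT : δ < T := (min_le_right _ _).trans_lt (by linarith)
  refine ⟨A * 2 ^ α, δ, by positivity, hδ0, hδT, fun t ht => ?_⟩
  have ht0 := ht.1
  have htT : t < T := ht.2.trans_lt hδT
  have hτ : 0 < t / 2 := by linarith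
  obtain ⟨M, hM, hzM⟩ := exists_ae_abs_le hz.continuousOn hz.locallyBounded hτ
    (by linarith : t / 2 ≤ t) htT
  -- A step of this length costs at most `t^{-α}/2` with the crude bound `M`.
  set h : ℝ := (1 / 2) * t ^ (-α) / (2 * K * M ^ (p - 1) * M + 1) with hh
  have hh0 : 0 < h := by positivity
  have key : ∀ k : ℕ, ∀ r ∈ Set.Ioc (t / 2) t, r - t / 2 ≤ k * h →
      ∀ᵐ x, |z r x| ≤ A * (r - t / 2) ^ (-α) := by
    intro k
    induction k with
    -- The range of `r` is empty, so no smallness near the starting time `t/2` is needed.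
    | zero =>
      intro r hr hrk
      exfalso
      simp only [Nat.cast_zero, zero_mul] at hrk
      linarith [hr.1]
    | succ k ih =>
      intro r hr hrk
      by_cases hle : r - t / 2 ≤ k * h
      · exact ih r hr hle
      push Not at hle
      have hrτ : 0 < r - t / 2 := sub_pos.2 hr.1
      have hkh : 0 ≤ k * h := by positivity
      push_cast at hrk
      have hstep := ae_abs_le_of_ae_abs_le (z := z) (τ := t / 2) (s := t / 2 + k * h) (t := r)
        (R := R) (A := A) (M := M) hq hp hβ hK hf.map_zero hfc hgr hA0.le (by linarith) hM
        (by linarith) (by linarith)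
        (fun σ hσ => hR σ ⟨by linarith [hσ.1], by linarith [hσ.2, hr.2]⟩)
        (fun σ hσ => ih σ ⟨hσ.1, by linarith [hσ.2, hr.2]⟩ (by linarith [hσ.2]))
        (fun σ hσ => hzM σ ⟨hσ.1, hσ.2.trans hr.2⟩)
        (hz.duhamel _ _ hτ hr.1 (by linarith [hr.2]))
      filter_upwards [hstep] with x hx
      refine hx.trans ?_
      have h1 := hT₁le (r - t / 2) ⟨hrτ, by
        linarith [hr.2, ht.2, min_le_left T₁ (T / 2)]⟩
      have h1' := mul_le_mul_of_nonneg_left h1 hA0.le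
      have h2 : 2 * K * M ^ (p - 1) * M * (r - (t / 2 + k * h)) ≤ 1 / 2 * (r - t / 2) ^ (-α) := by
        have h3 : 2 * K * M ^ (p - 1) * M * (r - (t / 2 + k * h)) ≤
            (2 * K * M ^ (p - 1) * M + 1) * h := by
          apply mul_le_mul <;> first | linarith | positivity
        have h4 : (2 * K * M ^ (p - 1) * M + 1) * h = 1 / 2 * t ^ (-α) := by
          rw [hh]; field_simp
        have h5 : t ^ (-α) ≤ (r - t / 2) ^ (-α) :=
          Real.rpow_le_rpow_of_nonpos hrτ (by linarith [hr.2]) (by linarith)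
        linarith
      have h6 : R + 2 * K * A ^ (p - 1) * A * 2 ^ α *
          ((r - t / 2) ^ (1 - α * (p - 1)) / (1 - α * (p - 1))) ≤ R + A / 2 := by
        have : A * (2 * K * A ^ (p - 1) * 2 ^ α / (1 - α * (p - 1)) *
          (r - t / 2) ^ (1 - α * (p - 1))) = 2 * K * A ^ (p - 1) * A * 2 ^ α *
          ((r - t / 2) ^ (1 - α * (p - 1)) / (1 - α * (p - 1))) := by ring
        linarith
      have h7 := mul_le_mul_of_nonneg_right h6 (by positivity : 0 ≤ (r - t / 2) ^ (-α))
      calc _ ≤ (R + A / 2) * (r - t / 2) ^ (-α) + 1 / 2 * (r - t / 2) ^ (-α) := add_le_add h7 h2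
        _ = A * (r - t / 2) ^ (-α) := by rw [hA]; ring
  obtain ⟨k, hk⟩ := exists_nat_ge ((t - t / 2) / h)
  rw [div_le_iff₀ hh0] at hk
  filter_upwards [key k t ⟨by linarith, le_rfl⟩ hk] with x hx
  refine hx.trans (le_of_eq ?_)
  rw [show t - t / 2 = t / 2 by ring, Real.div_rpow ht0.le (by norm_num),
    Real.rpow_neg (by norm_num : (0:ℝ) ≤ 2)]
  field_simp

theorem exists_weighted_bound_of_isSolution (hq : q ≠ ∞) (hp : 1 < p)
    (hqp : (n : ℝ) * (p - 1) / 2 < q.toReal) (hf : PowerNonlinearity p f) (hT : 0 < T)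
    (hz : IsSolution f y₀ T z) {T' : ℝ} (hT' : T' < T) :
    ∃ A : ℝ, 0 ≤ A ∧ ∀ t ∈ Set.Ioc 0 T',
      ∀ᵐ x, |z t x| ≤ A * t ^ (-((n : ℝ) / (2 * q.toReal))) := by
  have hq1 : 1 ≤ q := Fact.out
  obtain ⟨A, δ, hA, hδ, hδT, hsmall⟩ := ae_abs_le_of_isSolution hq hp hqp hf hT hz
  obtain ⟨M, hM, hzM⟩ := exists_ae_abs_le hz.continuousOn hz.locallyBounded hδ
    (le_max_left δ T') (max_lt hδT hT')
  set α := (n : ℝ) / (2 * q.toReal) with hα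
  have hα0 : 0 ≤ α := by positivity
  refine ⟨A + M * T ^ α, by positivity, fun t ht => ?_⟩
  have ht0 := ht.1
  rcases le_or_gt t δ with h | h
  · filter_upwards [hsmall t ⟨ht.1, h⟩] with x hx
    refine hx.trans ?_
    gcongr
    have : 0 ≤ M * T ^ α := by positivity
    linarith
  · filter_upwards [hzM t ⟨h.le, ht.2.trans (le_max_right _ _)⟩] with x hx
    refine hx.trans ?_
    have h1 : 1 ≤ T ^ α * t ^ (-α) := by
      rw [Real.rpow_neg ht0.le, ← div_eq_mul_inv, one_le_div (by positivity)]
      exact Real.rpow_le_rpow ht0.le (ht.2.trans hT'.le) hα0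
    have h2 := mul_le_mul_of_nonneg_left h1 hM
    have h3 : 0 ≤ A * t ^ (-α) := by positivity
    linarith

end APriori

/-! ### Uniqueness by an iterated Gronwall inequality -/

section Uniqueness

open Filter Topology

variable {n : ℕ} {q : ℝ≥0∞} {p : ℝ} {f : ℝ → ℝ} {K : ℝ} [Fact (1 ≤ q)] {T : ℝ}
  {y₀ : Lp ℝ q (volume : Measure (EuclideanSpace ℝ (Fin n)))}
  {y z : ℝ → Lp ℝ q (volume : Measure (EuclideanSpace ℝ (Fin n)))}

/-- One step of the iteration. The exponent `ε` may be negative: it is applied with a difference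
already known to decay like a positive power of `s`. -/
theorem norm_sub_le_of_duhamel (hq : q ≠ ∞) (hp : 1 < p) (hK : 0 < K) (hf0 : f 0 = 0)
    (hfc : Continuous f)
    (hf : ∀ a b : ℝ, |f a - f b| ≤ K * (|a| ^ (p - 1) + |b| ^ (p - 1)) * |a - b|)
    {A Θ ε τ t : ℝ} (hA : 0 ≤ A) (hΘ : 0 ≤ Θ) (hτ : 0 < τ) (hτt : τ < t) (htT : t ≤ T)
    (hε : (n : ℝ) / (2 * q.toReal) * (p - 1) + ε < 1)
    (hzc : ContinuousOn z (Set.Icc 0 T)) (hyc : ContinuousOn y (Set.Icc 0 T))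
    (hzA : ∀ s ∈ Set.Ioc 0 t, ∀ᵐ x, |z s x| ≤ A * s ^ (-((n : ℝ) / (2 * q.toReal))))
    (hyA : ∀ s ∈ Set.Ioc 0 t, ∀ᵐ x, |y s x| ≤ A * s ^ (-((n : ℝ) / (2 * q.toReal))))
    (hzy : ∀ s ∈ Set.Ioc 0 t, ‖z s - y s‖ ≤ Θ * s ^ (-ε))
    (hdz : Duhamel f z τ t) (hdy : Duhamel f y τ t) :
    ‖z t - y t‖ ≤ ‖z τ - y τ‖ + 2 * K * A ^ (p - 1) * Θ *
      (t ^ (1 - ((n : ℝ) / (2 * q.toReal) * (p - 1) + ε)) /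
        (1 - ((n : ℝ) / (2 * q.toReal) * (p - 1) + ε))) := by
  have hq1 : 1 ≤ q := Fact.out
  set α := (n : ℝ) / (2 * q.toReal) with hα
  -- Minkowski's inequality needs an integrand jointly measurable in time and space, which a curve
  -- of classes does not provide.
  obtain ⟨Z, hZm, hZ⟩ := exists_measurable_representative hzc
  obtain ⟨Y, hYm, hY⟩ := exists_measurable_representative hyc
  have hvm : ∀ v : Lp ℝ q (volume : Measure (EuclideanSpace ℝ (Fin n))), Measurable v :=
    fun v => (Lp.stronglyMeasurable v).measurable
  have hsub : ∀ s, eLpNorm (fun x => z s x - y s x) q volume = ENNReal.ofReal ‖z s - y s‖ := by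
    intro s
    rw [Lp.norm_def, ENNReal.ofReal_toReal (Lp.eLpNorm_ne_top _)]
    exact (eLpNorm_congr_ae (Lp.coeFn_sub (z s) (y s))).symm
  set g : ℝ → EuclideanSpace ℝ (Fin n) → ℝ := fun s x => f (Z s x) - f (Y s x) with hg
  have hgm : Measurable (Function.uncurry g) :=
    (hfc.measurable.comp hZm).sub (hfc.measurable.comp hYm)
  have hgae : ∀ s ∈ Set.Ioc τ t, g s =ᵐ[volume] fun x => f (z s x) - f (y s x) := by
    intro s hs
    have hs' : s ∈ Set.Icc 0 T := ⟨(hτ.trans hs.1).le, hs.2.trans htT⟩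
    filter_upwards [hZ s hs', hY s hs'] with x h1 h2
    simp only [hg, h1, h2]
  have hfin : ∀ v : ℝ → Lp ℝ q (volume : Measure (EuclideanSpace ℝ (Fin n))),
      (∀ s ∈ Set.Ioc 0 t, ∀ᵐ x, |v s x| ≤ A * s ^ (-α)) → ∀ s ∈ Set.Ioc 0 t,
      eLpNorm (fun x => f (v s x)) q volume ≠ ∞ := by
    intro v hv s hs
    have hs0 := hs.1
    exact ne_top_of_le_ne_top (ENNReal.mul_ne_top ENNReal.ofReal_ne_top (Lp.eLpNorm_ne_top (v s)))
      (eLpNorm_nonlinearity_le hp hK hf0 hf (by positivity) (hv s hs))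
  have hrep : ∀ᵐ x, z t x - y t x =
      heatSemigroup (t - τ) (fun w => z τ w - y τ w) x - duhamelIntegral g τ t x := by
    filter_upwards [hdz, hdy] with x h1 h2
    rw [h1.2, h2.2, heatSemigroup_sub hq1 hq (sub_pos.2 hτt) (hvm _) (Lp.eLpNorm_ne_top _) (hvm _)
      (Lp.eLpNorm_ne_top _)]
    have h3 : duhamelIntegral g τ t x =
        (∫ s in τ..t, heatSemigroup (t - s) (fun w => f (z s w)) x) -
          ∫ s in τ..t, heatSemigroup (t - s) (fun w => f (y s w)) x := by
      rw [← intervalIntegral.integral_sub h1.1 h2.1, intervalIntegral.integral_of_le hτt.le]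
      refine integral_congr_ae ?_
      filter_upwards [ae_Ioc_lt τ t] with s hs
      have hs' : s ∈ Set.Ioc 0 t := ⟨hτ.trans hs.1, hs.2.le⟩
      rw [heatSemigroup_congr_ae (hgae s ⟨hs.1, hs.2.le⟩)]
      exact heatSemigroup_sub hq1 hq (sub_pos.2 hs.2) (hfc.measurable.comp (hvm _))
        (hfin z hzA s hs') (hfc.measurable.comp (hvm _)) (hfin y hyA s hs') x
    rw [h3]; ring
  have hγ : 0 < 1 - (α * (p - 1) + ε) := by linarith
  have ht0 : 0 < t := hτ.trans hτt
  have hgint : ∫⁻ s in Set.Ioc τ t, eLpNorm (g s) q volume ≤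
      ENNReal.ofReal (2 * K * A ^ (p - 1) * Θ *
        (t ^ (1 - (α * (p - 1) + ε)) / (1 - (α * (p - 1) + ε)))) := by
    refine (lintegral_mono_ae (g := fun s => ENNReal.ofReal
      (2 * K * A ^ (p - 1) * Θ * s ^ (-(α * (p - 1) + ε)))) ?_).trans ?_
    · filter_upwards [self_mem_ae_restrict measurableSet_Ioc] with s hs
      have hs0 : 0 < s := hτ.trans hs.1
      have hs' : s ∈ Set.Ioc 0 t := ⟨hs0, hs.2⟩
      rw [eLpNorm_congr_ae (hgae s hs)]
      refine (eLpNorm_nonlinearity_sub_le hp hK hf (hzA s hs') (hyA s hs')).trans ?_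
      rw [hsub, ← ENNReal.ofReal_mul (by positivity)]
      refine ENNReal.ofReal_le_ofReal ?_
      rw [mul_rpow_neg_rpow hA hs0, neg_add, Real.rpow_add hs0]
      calc _ ≤ 2 * K * (A ^ (p - 1) * s ^ (-(α * (p - 1)))) * (Θ * s ^ (-ε)) := by
            gcongr; exact hzy s hs'
        _ = _ := by ring
    · rw [lintegral_mul_rpow_neg hε (by positivity) hτ.le hτt.le]
      refine ENNReal.ofReal_le_ofReal ?_
      have : 0 ≤ τ ^ (1 - (α * (p - 1) + ε)) := by positivity
      gcongr
      linarith
  have hmain : ENNReal.ofReal ‖z t - y t‖ ≤ ENNReal.ofReal (‖z τ - y τ‖ + 2 * K * A ^ (p - 1) * Θ *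
      (t ^ (1 - (α * (p - 1) + ε)) / (1 - (α * (p - 1) + ε)))) := by
    rw [ENNReal.ofReal_add (norm_nonneg _) (by positivity), ← hsub t, ← hsub τ,
      eLpNorm_congr_ae hrep]
    have hm1 : Measurable fun w => z τ w - y τ w := (hvm _).sub (hvm _)
    have hm2 : Measurable (duhamelIntegral g τ t) :=
      (measurable_duhamelIntegral hgm τ).comp measurable_prodMk_left
    refine (eLpNorm_sub_le (measurable_heatSemigroup _ hm1).aestronglyMeasurable
      hm2.aestronglyMeasurable hq1).trans (add_le_add ?_ ?_)
    · exact eLpNorm_heatSemigroup_le hq1 hq (sub_pos.2 hτt) hm1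
    · exact (eLpNorm_duhamelIntegral_le hq1 hq hgm τ t).trans hgint
  exact (ENNReal.ofReal_le_ofReal_iff (by positivity)).1 hmain

theorem eq_of_isSolution (hq : q ≠ ∞) (hp : 1 < p)
    (hqp : (n : ℝ) * (p - 1) / 2 < q.toReal) (hf : PowerNonlinearity p f)
    (hz : IsSolution f y₀ T z) (hy : IsSolution f y₀ T y) {t : ℝ} (ht : t ∈ Set.Ioo 0 T) :
    z t = y t := by
  have hq1 : 1 ≤ q := Fact.out
  have hβ := exponent_lt_one hq1 hq hqp
  have hT : 0 < T := ht.1.trans ht.2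
  obtain ⟨K, hK, hgr⟩ := hf.growth
  have hfc : Continuous f := hf.contDiff.continuous
  obtain ⟨A₁, hA₁, hzA⟩ := exists_weighted_bound_of_isSolution hq hp hqp hf hT hz ht.2
  obtain ⟨A₂, hA₂, hyA⟩ := exists_weighted_bound_of_isSolution hq hp hqp hf hT hy ht.2
  set α := (n : ℝ) / (2 * q.toReal) with hα
  set γ := 1 - α * (p - 1) with hγdef
  have hγ : 0 < γ := by rw [hγdef]; linarith
  set A := max A₁ A₂ with hA
  have hA0 : 0 ≤ A := hA₁.trans (le_max_left _ _)
  have hle : ∀ {v : ℝ → Lp ℝ q (volume : Measure (EuclideanSpace ℝ (Fin n)))} {B : ℝ}, B ≤ A →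
      (∀ s ∈ Set.Ioc 0 t, ∀ᵐ x, |v s x| ≤ B * s ^ (-α)) →
      ∀ s ∈ Set.Ioc 0 t, ∀ᵐ x, |v s x| ≤ A * s ^ (-α) := by
    intro v B hB hv s hs
    have hs0 := hs.1
    filter_upwards [hv s hs] with x hx
    exact hx.trans (by gcongr)
  have hzA' := hle (le_max_left A₁ A₂) hzA
  have hyA' := hle (le_max_right A₁ A₂) hyA
  have hwc : ContinuousOn (fun s => z s - y s) (Set.Icc 0 T) :=
    hz.continuousOn.sub hy.continuousOn
  obtain ⟨Θ, hΘ⟩ := isCompact_Icc.exists_bound_of_continuousOn hwc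
  have hΘ0 : 0 ≤ Θ := (norm_nonneg _).trans (hΘ 0 ⟨le_rfl, hT.le⟩)
  -- Duhamel's formula is available from `τ > 0` only; the common initial value removes the boundary
  -- term as `τ → 0`.
  have hw0 : Tendsto (fun τ => ‖z τ - y τ‖) (𝓝[>] 0) (𝓝 0) := by
    have h1 := (hwc 0 ⟨le_rfl, hT.le⟩).norm
    have h2 : Tendsto (fun τ => ‖z τ - y τ‖) (𝓝[Set.Icc 0 T] 0) (𝓝 ‖z 0 - y 0‖) := h1
    rw [hz.initial, hy.initial, sub_self, norm_zero] at h2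
    exact h2.mono_left (nhdsWithin_le_of_mem (Icc_mem_nhdsGT hT))
  set L := 2 * K * A ^ (p - 1) / γ with hL
  have hL0 : 0 ≤ L := by positivity
  have key : ∀ k : ℕ, ∀ s ∈ Set.Ioc 0 t,
      ‖z s - y s‖ ≤ Θ * L ^ k / k.factorial * s ^ (-(-(k * γ))) := by
    intro k
    induction k with
    | zero => intro s hs; simpa using hΘ s ⟨hs.1.le, hs.2.trans ht.2.le⟩
    | succ k ih =>
      intro s hs
      have hs0 := hs.1
      have hbound : ∀ τ ∈ Set.Ioo 0 s, ‖z s - y s‖ ≤ ‖z τ - y τ‖ +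
          Θ * L ^ (k + 1) / (k + 1).factorial * s ^ (-(-((k + 1 : ℕ) * γ))) := by
        intro τ hτ
        have hkγ : 0 ≤ k * γ := by positivity
        have := norm_sub_le_of_duhamel (ε := -(k * γ)) hq hp hK hf.map_zero hfc hgr hA0
          (Θ := Θ * L ^ k / k.factorial) (by positivity) hτ.1 hτ.2 (hs.2.trans ht.2.le)
          (by linarith) hz.continuousOn hy.continuousOn
          (fun r hr => hzA' r ⟨hr.1, hr.2.trans hs.2⟩) (fun r hr => hyA' r ⟨hr.1, hr.2.trans hs.2⟩)
          (fun r hr => ih r ⟨hr.1, hr.2.trans hs.2⟩)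
          (hz.duhamel τ s hτ.1 hτ.2 (hs.2.trans_lt ht.2))
          (hy.duhamel τ s hτ.1 hτ.2 (hs.2.trans_lt ht.2))
        refine this.trans (le_of_eq ?_)
        -- Each integration divides by `(k + 1) γ`, which builds the factorial.
        rw [← hα, show 1 - (α * (p - 1) + -(k * γ)) = (k + 1 : ℝ) * γ by rw [hγdef]; ring,
          neg_neg, Nat.factorial_succ, pow_succ]
        push_cast
        rw [hL]
        field_simp
      have hlim := hw0.add_const
        (Θ * L ^ (k + 1) / (k + 1).factorial * s ^ (-(-((k + 1 : ℕ) * γ))))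
      rw [zero_add] at hlim
      refine ge_of_tendsto hlim ?_
      filter_upwards [Ioo_mem_nhdsGT hs0] with τ hτ using hbound τ hτ
  have hlim : Tendsto (fun k : ℕ => Θ * ((L * t ^ γ) ^ k / k.factorial)) atTop (𝓝 (Θ * 0)) :=
    (FloorSemiring.tendsto_pow_div_factorial_atTop (L * t ^ γ)).const_mul Θ
  rw [mul_zero] at hlim
  have hzero : ‖z t - y t‖ ≤ 0 := by
    refine ge_of_tendsto hlim (Eventually.of_forall fun k => ?_)
    refine (key k t ⟨ht.1, le_rfl⟩).trans (le_of_eq ?_)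
    rw [neg_neg, mul_comm (k : ℝ) γ, Real.rpow_mul ht.1.le, Real.rpow_natCast, mul_pow]
    ring
  exact sub_eq_zero.1 (norm_le_zero_iff.1 hzero)

theorem eqOn_of_isSolution (hq : q ≠ ∞) (hp : 1 < p)
    (hqp : (n : ℝ) * (p - 1) / 2 < q.toReal) (hf : PowerNonlinearity p f) (hT : 0 < T)
    (hz : IsSolution f y₀ T z) (hy : IsSolution f y₀ T y) : Set.EqOn z y (Set.Icc 0 T) := by
  have h : Set.EqOn z y (Set.Ioo 0 T) := fun t ht => eq_of_isSolution hq hp hqp hf hz hy ht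
  -- Continuity covers the endpoint `T`, at which solutions are not required to satisfy Duhamel's
  -- formula.
  exact h.of_subset_closure hz.continuousOn hy.continuousOn Set.Ioo_subset_Icc_self
    (closure_Ioo hT.ne).ge

end Uniqueness

end SemilinearHeat

end

theorem theorem3p2 (n : ℕ) (hn : 0 < n) (p : ℝ) (hp : 1 < p)
    (q : ℝ≥0∞) [Fact (1 ≤ q)] (hq : q ≠ ∞) (hqp : (n : ℝ) * (p - 1) / 2 < q.toReal) :
    ∃ C : ℝ → ℝ → ℝ, (∀ r T : ℝ, 0 < C r T) ∧
      ∀ f : ℝ → ℝ, SemilinearHeat.PowerNonlinearity p f →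
      ∀ y₀ : Lp ℝ q (volume : Measure (EuclideanSpace ℝ (Fin n))),
      ∃ T : ℝ, 0 < T ∧
        ∃ y : ℝ → Lp ℝ q (volume : Measure (EuclideanSpace ℝ (Fin n))),
          SemilinearHeat.IsSolution f y₀ T y ∧
          (∀ t ∈ Set.Ioc 0 T, SemilinearHeat.Duhamel f y 0 t) ∧
          (∀ z : ℝ → Lp ℝ q (volume : Measure (EuclideanSpace ℝ (Fin n))),
            SemilinearHeat.IsSolution f y₀ T z → Set.EqOn z y (Set.Icc 0 T)) ∧
          ∀ t ∈ Set.Ioc 0 T, MemLp (y t) ∞ volume ∧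
            ‖y t‖ + t ^ ((n : ℝ) / (2 * q.toReal)) * (eLpNorm (y t) ∞ volume).toReal
              ≤ C ‖y₀‖ T * ‖y₀‖ := by
  refine ⟨fun _ _ => 4, fun _ _ => by norm_num, fun f hf y₀ => ?_⟩
  obtain ⟨T, hT, y, hy, hduh, hbound⟩ := SemilinearHeat.exists_isSolution hq hp hqp hf y₀
  exact ⟨T, hT, y, hy, hduh,
    fun z hz => SemilinearHeat.eqOn_of_isSolution hq hp hqp hf hT hz hy, hbound⟩
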